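/- For an integer $j\ge 0$ let $d_j(n)$ denote the number of ways of writing $n\ge 1$ as an ordered product of $j$ positive integers (so $d_0(n)=1_{n=1}$), let $\Omega(m)$ be the number of prime factors of $m$ counted with multiplicity, and write $e(x)=e^{2\pi i x}$. For an integer $k\ge 1$, real $X\ge 3$ and $0<\varepsilon'<1$ put $M:=X^{2k/\log\log X}$ and $$\tilde d_k(n):=1_{(X,2X]}(n)\sum_{\substack{m\mid n,\ m\le M\\ \Omega(m)\le (1+\varepsilon')k\log\log X}} d_{k-1}(m).$$ **Proposition.** Let $k\ge 1$ be an integer. There are a constant $C=C(k)>0$ and a function $\eta=\eta_k:\mathbb R\to\mathbb R$ with $\eta(X)\to 0$ as $X\to\infty$ such that the following holds for all $\varepsilon>0$ and $0<\varepsilon'<1$. Let $X\ge 3$, let $$X\ge H_1\ge(\log X)^{10k\log k},\qquad Q_1\le\min\left\{\frac{H_1^{2/5}}{(\log X)^{(1+2\varepsilon)k\log k}},\ (\log X)^{10000k^{10}}\right\},$$ and let $\alpha\in\mathbb R$ satisfy $|\alpha-\frac aq|<\frac1{qQ_1}$ for some integers $a$ and $1\le q\le Q_1$ with $(a,q)=1$.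 Then there is a measurable set $\mathcal E\subset[X/2,2X]$ (which may depend on all the preceding data, including $\alpha$) of Lebesgue measure $$m(\mathcal E)\le C\,\frac{X(\log X)^{3k\log k}}{Q_1^{1/4}}$$ such that for all $x\in[X/2,2X]\setminus\mathcal E$ one has $$\left|\sum_{x\le n\le x+H_1}\tilde d_k(n)e(\alpha n)\right|\le C\left(\frac1q+\frac1{Q_1^{1/8}}\right)H_1(\log X)^{k-1+\eta(X)}.$$ -/

import Mathlib

open Filter Topology MeasureTheory

/-- The `k`-fold divisor function `d_k(n)`, i.e. the number of ways of writing `n ≥ 1` as an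
ordered product of `k` positive integers: the `k`-th Dirichlet convolution power of the constant
function `1`. In particular `d_0` is the indicator function of `n = 1`, and `d_1 = 1`. -/
def divisorFun (k n : ℕ) : ℕ := (ArithmeticFunction.zeta ^ k) n

/-- The additive character `e(x) = exp(2 π i x)`. -/
noncomputable def expChar (x : ℝ) : ℂ := Complex.exp (2 * Real.pi * Complex.I * x)

/-- The truncation level `M = X ^ (2k / log log X)`. -/
noncomputable def truncLevel (k : ℕ) (X : ℝ) : ℝ :=
  X ^ (2 * (k : ℝ) / Real.log (Real.log X))

/-- The truncated divisor sum
`∑_{m ∣ n, m ≤ M, Ω(m) ≤ (1 + ε') k log log X} d_{k-1}(m)`, restricted to `X < n ≤ 2X`.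
Here `Ω` counts prime factors with multiplicity. -/
noncomputable def truncDivisor (k : ℕ) (ε' X : ℝ) (n : ℕ) : ℝ :=
  open Classical in
  if X < (n : ℝ) ∧ (n : ℝ) ≤ 2 * X then
    ∑ m ∈ n.divisors.filter (fun m : ℕ => (m : ℝ) ≤ truncLevel k X ∧
        (ArithmeticFunction.cardFactors m : ℝ) ≤ (1 + ε') * k * Real.log (Real.log X)),
      (divisorFun (k - 1) m : ℝ)
  else 0

/-- The short exponential sum `∑_{x ≤ n ≤ x + H₁} \tilde d_k(n) e(α n)`, for `x > 0`. -/
noncomputable def shortExpSum (k : ℕ) (ε' X H₁ α x : ℝ) : ℂ :=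
  ∑ n ∈ Finset.Icc ⌈x⌉₊ ⌊x + H₁⌋₊, (truncDivisor k ε' X n : ℂ) * expChar (α * n)

/-!
Write `L = log X`, `D = d_{k-1}`, and let `S` be the set of moduli `m` in the truncated divisor
sum. Opening that sum, the exponential sum over `[x, x + H]` becomes `∑ m ∈ S, D m * T_m`, where
`T_m` is the sum of `e(α n)` over the multiples `n` of `m` in the window and in `(X, 2X]`. It
depends only on `t = ⌈x⌉` and on the number `K` of integers in the window, which is `⌊H⌋` or
`⌊H⌋ + 1`; so it suffices to control it for all but few integers `t`. The moduli divisible by `q`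
and the others are treated separately.

* The moduli divisible by `q` contribute at most `A(t) = ∑_{q ∣ m} D m N_m(t)`, whatever `α` is,
  where `N_m(t)` counts the multiples of `m` in the window. The variance of `A` over `t` is small
  (`sum_sq_windowCount_sub_mean_le`), because the correlation of `N_m` and `N_{m'}` exceeds the
  product of their means by at most `K / lcm(m, m')` per position, up to a boundary term
  independent of the number of positions. The mean of `A` is
  `K ∑_{q ∣ m} D m / m ≤ K (d_{k-1}(q) / q) (1 + log M) ^ (k - 1)`, and
  `d_{k-1}(q) ≤ L ^ o(1)` by the divisor bound, since `q` is at most a power of `L`.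

* For the moduli not divisible by `q` the second moment over `t` is small
  (`sum_norm_sq_windowSum_le`). Integers `n`, `n'` divisible by `m`, `m'` differ by a multiple of
  `g = gcd(m, m')`, so the correlation of `T_m` and `T_{m'}` is a weighted geometric sum with ratio
  `e(α g)`. As `q ∤ g`, the approximation `a / q` to `α` keeps `α g` at distance `1 / (2q)` from the
  integers if `g ≤ Q / 2`; if `g > Q / 2`, the trivial bound is good enough.

Both moments lose only a fixed power of `L`: the restriction on `Ω(m)` gives
`D m ≤ L ^ (2 k log k)`, and `∑ 1 / lcm(m, m') ≤ (1 + log M) ^ 3`. This loss is harmless if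
`Q ≥ L ^ (12 k log k)`. For smaller `Q` the bound allowed for the measure of the exceptional set
exceeds the length of `[X / 2, 2X]`, so that all points may be exceptional. Chebyshev's
inequality concludes (`exists_bad_positions`).
-/

open scoped ComplexConjugate

/-! ### Divisor functions -/

lemma divisorFun_succ (j n : ℕ) : divisorFun (j + 1) n = ∑ d ∈ n.divisors, divisorFun j d := by
  simp only [divisorFun, pow_succ]
  exact ArithmeticFunction.mul_zeta_apply

lemma divisorFun_zero_left (n : ℕ) : divisorFun 0 n = if n = 1 then 1 else 0 := by
  simp [divisorFun, ArithmeticFunction.one_apply]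

lemma divisorFun_one_right (j : ℕ) : divisorFun j 1 = 1 := by
  induction j with
  | zero => simp [divisorFun_zero_left]
  | succ j ih => simp [divisorFun_succ, ih]

lemma divisorFun_prime (j : ℕ) {p : ℕ} (hp : p.Prime) : divisorFun j p = j := by
  induction j with
  | zero => simp [divisorFun_zero_left, hp.ne_one]
  | succ j ih =>
    rw [divisorFun_succ, hp.divisors, Finset.sum_pair hp.ne_one.symm, ih, divisorFun_one_right,
      add_comm]

/-- Submultiplicativity for arbitrary arguments, by induction on `j`: every divisor of `m * n` is a
product of a divisor of `m` and a divisor of `n`. -/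
lemma divisorFun_mul_le (j m n : ℕ) :
    divisorFun j (m * n) ≤ divisorFun j m * divisorFun j n := by
  induction j generalizing m n with
  | zero =>
    simp only [divisorFun_zero_left, mul_eq_one]
    split_ifs <;> simp_all
  | succ j ih =>
    simp only [divisorFun_succ]
    have himg : (m * n).divisors = (m.divisors ×ˢ n.divisors).image (fun p => p.1 * p.2) := by
      rw [Nat.divisors_mul]; rfl
    rw [himg, Finset.sum_mul_sum, ← Finset.sum_product']
    refine (Finset.sum_image_le_of_nonneg ?_).trans (Finset.sum_le_sum fun p _ => ih _ _)
    intros; exact Nat.zero_le _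

lemma divisorFun_le_pow_cardFactors (j : ℕ) {m : ℕ} (hm : m ≠ 0) :
    divisorFun j m ≤ j ^ ArithmeticFunction.cardFactors m := by
  induction m using Nat.recOnMul with
  | zero => exact absurd rfl hm
  | one => simp [divisorFun_one_right]
  | prime p hp => simp [divisorFun_prime j hp, ArithmeticFunction.cardFactors_apply_prime hp]
  | mul a b iha ihb =>
    obtain ⟨ha, hb⟩ := mul_ne_zero_iff.mp hm
    rw [ArithmeticFunction.cardFactors_mul ha hb, pow_add]
    exact (divisorFun_mul_le j a b).trans (Nat.mul_le_mul (iha ha) (ihb hb))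

lemma sum_one_div_Icc_le (N : ℕ) : ∑ u ∈ Finset.Icc 1 N, 1 / (u : ℝ) ≤ 1 + Real.log N := by
  have h := harmonic_le_one_add_log N
  rw [harmonic_eq_sum_Icc] at h
  push_cast at h
  simpa using h

lemma sum_divisorFun_div_le (j N : ℕ) :
    ∑ u ∈ Finset.Icc 1 N, (divisorFun j u : ℝ) / u ≤ (1 + Real.log N) ^ j := by
  induction j with
  | zero =>
    simp only [divisorFun_zero_left, pow_zero]
    calc ∑ u ∈ Finset.Icc 1 N, (((if u = 1 then 1 else 0 : ℕ) : ℝ)) / u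
        ≤ ∑ u ∈ Finset.Icc 1 N, if u = 1 then 1 else 0 := by
          refine Finset.sum_le_sum fun u _ => ?_
          split_ifs with h <;> simp [h]
      _ ≤ 1 := by rw [Finset.sum_ite_eq']; split_ifs <;> norm_num
  | succ j ih =>
    have hlog : 0 ≤ Real.log N := Real.log_natCast_nonneg N
    calc ∑ u ∈ Finset.Icc 1 N, (divisorFun (j + 1) u : ℝ) / u
        = ∑ u ∈ Finset.Icc 1 N, ∑ p ∈ u.divisorsAntidiagonal,
            (divisorFun j p.1 : ℝ) / p.1 * (1 / p.2) := by
          refine Finset.sum_congr rfl fun u _ => ?_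
          rw [divisorFun_succ, Nat.cast_sum, Finset.sum_div,
            ← Nat.sum_divisorsAntidiagonal (fun d _ => (divisorFun j d : ℝ) / (u : ℝ))]
          refine Finset.sum_congr rfl fun p hp => ?_
          rw [← (Nat.mem_divisorsAntidiagonal.mp hp).1]
          push_cast
          rw [div_mul_div_comm, mul_one]
      _ ≤ ∑ p ∈ Finset.Icc 1 N ×ˢ Finset.Icc 1 N, (divisorFun j p.1 : ℝ) / p.1 * (1 / p.2) := by
          rw [← Finset.sum_biUnion]
          · refine Finset.sum_le_sum_of_subset_of_nonneg ?_ fun _ _ _ => by positivity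
            intro p hp
            simp only [Finset.mem_biUnion, Finset.mem_Icc, Nat.mem_divisorsAntidiagonal] at hp
            obtain ⟨u, ⟨hu1, huN⟩, hpu, hu0⟩ := hp
            have h1 : p.1 ≠ 0 := by rintro h; simp [h] at hpu; omega
            have h2 : p.2 ≠ 0 := by rintro h; simp [h] at hpu; omega
            simp only [Finset.mem_product, Finset.mem_Icc]
            refine ⟨⟨by omega, ?_⟩, by omega, ?_⟩
            · exact ((Nat.le_mul_of_pos_right _ (by omega)).trans hpu.le).trans huN
            · exact ((Nat.le_mul_of_pos_left _ (by omega)).trans hpu.le).trans huN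
          · intro u _ v _ huv
            simp only [Function.onFun]
            rw [Finset.disjoint_left]
            intro p hp hq
            exact huv ((Nat.mem_divisorsAntidiagonal.mp hp).1.symm.trans
              (Nat.mem_divisorsAntidiagonal.mp hq).1)
      _ = (∑ u ∈ Finset.Icc 1 N, (divisorFun j u : ℝ) / u) * ∑ u ∈ Finset.Icc 1 N, 1 / (u : ℝ) := by
          rw [Finset.sum_mul_sum, ← Finset.sum_product']
      _ ≤ (1 + Real.log N) ^ (j + 1) := by
          rw [pow_succ]
          exact mul_le_mul ih (sum_one_div_Icc_le N) (Finset.sum_nonneg fun _ _ => by positivity)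
            (by positivity)

/-- A pair `(m, n)` is determined by `g = gcd(m, n)`, `m / g` and `n / g`, and `lcm(m, n)` is the
product of these three numbers. -/
lemma sum_one_div_lcm_le (N : ℕ) :
    ∑ m ∈ Finset.Icc 1 N, ∑ n ∈ Finset.Icc 1 N, 1 / (Nat.lcm m n : ℝ) ≤
      (1 + Real.log N) ^ 3 := by
  have hlog : 0 ≤ Real.log N := Real.log_natCast_nonneg N
  set I := Finset.Icc 1 N with hI
  calc ∑ m ∈ I, ∑ n ∈ I, 1 / (Nat.lcm m n : ℝ)
      = ∑ p ∈ I ×ˢ I, 1 / (Nat.lcm p.1 p.2 : ℝ) := by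
        rw [← Finset.sum_product']
    _ = ∑ p ∈ (I ×ˢ I).image (fun p : ℕ × ℕ =>
          (p.1.gcd p.2, p.1 / p.1.gcd p.2, p.2 / p.1.gcd p.2)),
          1 / (p.1 : ℝ) * (1 / p.2.1 * (1 / p.2.2)) := by
        rw [Finset.sum_image]
        · refine Finset.sum_congr rfl fun p hp => ?_
          simp only [hI, Finset.mem_product, Finset.mem_Icc] at hp
          have hg : 0 < p.1.gcd p.2 := Nat.gcd_pos_of_pos_left _ hp.1.1
          obtain ⟨u, hu⟩ := Nat.gcd_dvd_left p.1 p.2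
          obtain ⟨v, hv⟩ := Nat.gcd_dvd_right p.1 p.2
          have hu' : p.1 / p.1.gcd p.2 = u := Nat.div_eq_of_eq_mul_right hg hu
          have hv' : p.2 / p.1.gcd p.2 = v := Nat.div_eq_of_eq_mul_right hg hv
          have hl : p.1.lcm p.2 = p.1.gcd p.2 * (u * v) := by
            apply Nat.eq_of_mul_eq_mul_left hg
            rw [Nat.gcd_mul_lcm]
            calc p.1 * p.2 = (p.1.gcd p.2 * u) * (p.1.gcd p.2 * v) := by rw [← hu, ← hv]
              _ = _ := by ring
          rw [hu', hv', hl]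
          push_cast
          rw [one_div_mul_one_div, one_div_mul_one_div]
        · intro p _ p' _ h
          simp only [Prod.mk.injEq] at h
          obtain ⟨h1, h2, h3⟩ := h
          ext
          · rw [← Nat.div_mul_cancel (Nat.gcd_dvd_left p.1 p.2), h2, h1,
              Nat.div_mul_cancel (Nat.gcd_dvd_left p'.1 p'.2)]
          · rw [← Nat.div_mul_cancel (Nat.gcd_dvd_right p.1 p.2), h3, h1,
              Nat.div_mul_cancel (Nat.gcd_dvd_right p'.1 p'.2)]
    _ ≤ ∑ p ∈ I ×ˢ (I ×ˢ I), 1 / (p.1 : ℝ) * (1 / p.2.1 * (1 / p.2.2)) := by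
        refine Finset.sum_le_sum_of_subset_of_nonneg ?_ fun _ _ _ => by positivity
        intro x hx
        simp only [Finset.mem_image, Finset.mem_product, hI, Finset.mem_Icc] at hx ⊢
        obtain ⟨p, ⟨⟨h1, h2⟩, h3, h4⟩, rfl⟩ := hx
        have hg : 0 < p.1.gcd p.2 := Nat.gcd_pos_of_pos_left _ h1
        have hg1 := Nat.gcd_le_left p.2 h1
        have hg2 := Nat.gcd_le_right p.1 h3
        exact ⟨⟨hg, by omega⟩, ⟨Nat.div_pos hg1 hg, (Nat.div_le_self _ _).trans h2⟩,
          Nat.div_pos hg2 hg, (Nat.div_le_self _ _).trans h4⟩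
    _ = (∑ u ∈ I, 1 / (u : ℝ)) * ((∑ u ∈ I, 1 / (u : ℝ)) * ∑ u ∈ I, 1 / (u : ℝ)) := by
        rw [Finset.sum_mul_sum I I, ← Finset.sum_product', Finset.sum_mul_sum,
          ← Finset.sum_product']
    _ ≤ (1 + Real.log N) ^ 3 := by
        have h := sum_one_div_Icc_le N
        have h0 : 0 ≤ ∑ u ∈ I, 1 / (u : ℝ) := Finset.sum_nonneg fun _ _ => by positivity
        calc _ = (∑ u ∈ I, 1 / (u : ℝ)) ^ 3 := by ring
          _ ≤ _ := by gcongr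

/-- The divisor bound for the number of divisors. Factoring `n`, a prime power `p ^ a` with
`2 ≤ p ^ δ` contributes `a + 1 ≤ 2 ^ a ≤ p ^ (a δ)`, while the boundedly many smaller primes
contribute at most a constant factor each. -/
lemma exists_card_divisors_le_rpow {δ : ℝ} (hδ : 0 < δ) :
    ∃ C : ℝ, 1 ≤ C ∧ ∀ n : ℕ, n ≠ 0 → (n.divisors.card : ℝ) ≤ C * (n : ℝ) ^ δ := by
  obtain ⟨P, hP⟩ := exists_nat_ge ((2 : ℝ) ^ (1 / δ))
  -- the factor allotted to each prime below `P`
  obtain ⟨B, hB1, hB⟩ : ∃ B : ℝ, 1 ≤ B ∧ ∀ a : ℕ, (a : ℝ) + 1 ≤ B * (2 : ℝ) ^ (δ * a) := by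
    have hl : 0 < δ * Real.log 2 := mul_pos hδ (Real.log_pos (by norm_num))
    refine ⟨max 1 (1 / (δ * Real.log 2)), le_max_left _ _, fun a => ?_⟩
    have h1 : 1 + δ * Real.log 2 * a ≤ (2 : ℝ) ^ (δ * a) := by
      rw [Real.rpow_def_of_pos (by norm_num)]
      have := Real.add_one_le_exp (Real.log 2 * (δ * a))
      linarith
    have h2 : (a : ℝ) ≤ max 1 (1 / (δ * Real.log 2)) * (δ * Real.log 2 * a) := by
      calc (a : ℝ) = 1 / (δ * Real.log 2) * (δ * Real.log 2 * a) := by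
            field_simp [hl.ne', (Real.log_pos (by norm_num : (1 : ℝ) < 2)).ne']
        _ ≤ _ := by gcongr; exact le_max_right _ _
    calc (a : ℝ) + 1 ≤ max 1 (1 / (δ * Real.log 2)) * (δ * Real.log 2 * a)
          + max 1 (1 / (δ * Real.log 2)) := add_le_add h2 (le_max_left _ _)
      _ = max 1 (1 / (δ * Real.log 2)) * (1 + δ * Real.log 2 * a) := by ring
      _ ≤ _ := by gcongr
  have key : ∀ n : ℕ, n ≠ 0 → (n.divisors.card : ℝ) ≤
      B ^ (n.primeFactors.filter (· < P)).card * (n : ℝ) ^ δ := by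
    intro n
    induction n using Nat.recOnPosPrimePosCoprime with
    | zero => intro h; exact absurd rfl h
    | one => intro _; simp
    | prime_pow p a hp ha =>
      intro _
      rw [Nat.divisors_prime_pow hp, Finset.card_map, Finset.card_range,
        Nat.primeFactors_prime_pow ha.ne' hp, Finset.filter_singleton]
      have hp0 : (0 : ℝ) ≤ p := Nat.cast_nonneg p
      have hp2 : (2 : ℝ) ≤ p := by exact_mod_cast hp.two_le
      have hpow : (((p ^ a : ℕ) : ℝ)) ^ δ = ((p : ℝ) ^ δ) ^ a := by
        push_cast
        rw [← Real.rpow_natCast, ← Real.rpow_mul hp0, mul_comm, Real.rpow_mul hp0,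
          Real.rpow_natCast]
      rw [hpow]
      push_cast
      split_ifs with h
      · rw [Finset.card_singleton, pow_one]
        refine (hB a).trans ?_
        rw [Real.rpow_mul (by norm_num), Real.rpow_natCast]
        gcongr
      · rw [Finset.card_empty, pow_zero, one_mul]
        have h2 : (2 : ℝ) ≤ (p : ℝ) ^ δ := by
          have hPp : (2 : ℝ) ^ (1 / δ) ≤ p := hP.trans (by exact_mod_cast not_lt.mp h)
          calc (2 : ℝ) = ((2 : ℝ) ^ (1 / δ)) ^ δ := by
                rw [← Real.rpow_mul (by norm_num), one_div_mul_cancel hδ.ne', Real.rpow_one]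
            _ ≤ _ := by gcongr
        calc (a : ℝ) + 1 ≤ 2 ^ a := by exact_mod_cast Nat.lt_two_pow_self (n := a)
          _ ≤ _ := by gcongr
    | coprime a b ha hb hab iha ihb =>
      intro _
      have ha' := iha (by omega)
      have hb' := ihb (by omega)
      rw [hab.card_divisors_mul, Nat.Coprime.primeFactors_mul hab, Finset.filter_union,
        Finset.card_union_of_disjoint (Finset.disjoint_filter_filter hab.disjoint_primeFactors)]
      push_cast
      rw [Real.mul_rpow (by positivity) (by positivity), pow_add]
      calc _ ≤ _ := mul_le_mul ha' hb' (by positivity) (by positivity)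
        _ = _ := by ring
  refine ⟨B ^ P, one_le_pow₀ hB1, fun n hn => (key n hn).trans ?_⟩
  have hcard : (n.primeFactors.filter (· < P)).card ≤ P := by
    calc _ ≤ (Finset.range P).card := Finset.card_le_card fun p hp => by
          simpa using (Finset.mem_filter.mp hp).2
      _ = P := Finset.card_range P
  gcongr

lemma exists_divisorFun_le_rpow (j : ℕ) {δ : ℝ} (hδ : 0 < δ) :
    ∃ C : ℝ, 1 ≤ C ∧ ∀ n : ℕ, n ≠ 0 → (divisorFun j n : ℝ) ≤ C * (n : ℝ) ^ δ := by
  induction j generalizing δ with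
  | zero =>
    refine ⟨1, le_rfl, fun n hn => ?_⟩
    have : (1 : ℝ) ≤ n := by exact_mod_cast Nat.one_le_iff_ne_zero.mpr hn
    have := Real.one_le_rpow this hδ.le
    rw [divisorFun_zero_left]
    split_ifs <;> push_cast <;> linarith
  | succ j ih =>
    obtain ⟨C, hC1, hC⟩ := ih (half_pos hδ)
    obtain ⟨C', hC1', hC'⟩ := exists_card_divisors_le_rpow (half_pos hδ)
    refine ⟨C' * C, one_le_mul_of_one_le_of_one_le hC1' hC1, fun n hn => ?_⟩
    have hn0 : (0 : ℝ) < n := by exact_mod_cast Nat.pos_of_ne_zero hn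
    rw [divisorFun_succ, Nat.cast_sum]
    calc ∑ d ∈ n.divisors, (divisorFun j d : ℝ) ≤ ∑ d ∈ n.divisors, C * (n : ℝ) ^ (δ / 2) := by
          refine Finset.sum_le_sum fun d hd => (hC d (Nat.pos_of_mem_divisors hd).ne').trans ?_
          have := Nat.divisor_le hd
          gcongr
      _ = n.divisors.card * (C * (n : ℝ) ^ (δ / 2)) := by simp
      _ ≤ C' * (n : ℝ) ^ (δ / 2) * (C * (n : ℝ) ^ (δ / 2)) := by
          gcongr; exact hC' n hn
      _ = C' * C * ((n : ℝ) ^ (δ / 2) * (n : ℝ) ^ (δ / 2)) := by ring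
      _ = _ := by rw [← Real.rpow_add hn0, add_halves]

/-! ### Multiples of a modulus in a window -/

lemma abs_card_Ioc_filter_modEq_sub_le {a b : ℤ} (hab : a ≤ b) {P : ℤ} (hP : 0 < P) (v : ℤ) :
    |(((Finset.Ioc a b).filter (fun t => t ≡ v [ZMOD P])).card : ℝ) - ((b : ℝ) - a) / P| ≤ 1 := by
  have h := Int.Ioc_filter_modEq_card a b hP v
  have hP' : (0 : ℚ) < P := by exact_mod_cast hP
  have hle : ((a : ℚ) - v) / P ≤ (b - v) / P := by
    have : (a : ℚ) ≤ b := by exact_mod_cast hab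
    gcongr
  rw [max_eq_left (sub_nonneg.mpr (Int.floor_le_floor hle))] at h
  have hq : |(((Finset.Ioc a b).filter (fun t => t ≡ v [ZMOD P])).card : ℚ)
      - ((b : ℚ) - a) / P| ≤ 1 := by
    have h' : (((Finset.Ioc a b).filter (fun t => t ≡ v [ZMOD P])).card : ℚ) =
        ⌊((b : ℚ) - v) / P⌋ - ⌊((a : ℚ) - v) / P⌋ := by exact_mod_cast h
    have e : ((b : ℚ) - a) / P = (b - v) / P - (a - v) / P := by ring
    rw [h', e, abs_le]
    have h1 := Int.floor_le (((b : ℚ) - v) / P)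
    have h2 := Int.lt_floor_add_one (((b : ℚ) - v) / P)
    have h3 := Int.floor_le (((a : ℚ) - v) / P)
    have h4 := Int.lt_floor_add_one (((a : ℚ) - v) / P)
    constructor <;> linarith
  exact_mod_cast hq

/-- Chinese remainder theorem for two moduli that need not be coprime. -/
lemma Int.exists_dvd_add_and_dvd_add {m m' i i' : ℤ} (h : (Int.gcd m m' : ℤ) ∣ i' - i) :
    ∃ t : ℤ, m ∣ t + i ∧ m' ∣ t + i' := by
  obtain ⟨c, hc⟩ := h
  have hg := Int.gcd_eq_gcd_ab m m'
  refine ⟨-i - m * (Int.gcdA m m' * c), ⟨-(Int.gcdA m m' * c), by ring⟩,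
    ⟨Int.gcdB m m' * c, ?_⟩⟩
  have : i' - i = (m * Int.gcdA m m' + m' * Int.gcdB m m') * c := by rw [hc, hg]
  linear_combination this

lemma filter_dvd_add_eq_filter_modEq (s : Finset ℤ) {m m' : ℕ} {i i' t₀ : ℤ}
    (h : (m : ℤ) ∣ t₀ + i) (h' : (m' : ℤ) ∣ t₀ + i') :
    s.filter (fun t => (m : ℤ) ∣ t + i ∧ (m' : ℤ) ∣ t + i') =
      s.filter (fun t => t ≡ t₀ [ZMOD (Nat.lcm m m' : ℕ)]) := by
  refine Finset.filter_congr fun t _ => ?_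
  have key : ∀ (n : ℤ) (j : ℤ), n ∣ t₀ + j → (n ∣ t + j ↔ t ≡ t₀ [ZMOD n]) := by
    intro n j hj
    rw [Int.modEq_comm, Int.modEq_iff_dvd, ← add_sub_add_right_eq_sub t t₀ j]
    exact (dvd_sub_left hj).symm
  rw [key _ _ h, key _ _ h', Int.modEq_and_modEq_iff_modEq_lcm]
  rfl

/-- The integers `t` in an interval with `m ∣ t + i` and `m' ∣ t + i'` have density
`1 / lcm(m, m')`, provided `gcd(m, m')` divides `i' - i`. -/
lemma abs_card_filter_dvd_add_sub_le {a b : ℤ} (hab : a ≤ b) {m m' : ℕ} (hm : 0 < m)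
    (hm' : 0 < m') {i i' : ℤ} (h : (Nat.gcd m m' : ℤ) ∣ i' - i) :
    |(((Finset.Ioc a b).filter (fun t : ℤ => (m : ℤ) ∣ t + i ∧ (m' : ℤ) ∣ t + i')).card : ℝ)
      - ((b : ℝ) - a) / (Nat.lcm m m' : ℕ)| ≤ 1 := by
  obtain ⟨t₀, h1, h2⟩ := Int.exists_dvd_add_and_dvd_add (m := m) (m' := m') (i := i) (i' := i')
    (by simpa using h)
  rw [filter_dvd_add_eq_filter_modEq _ h1 h2]
  have hP : (0 : ℤ) < (Nat.lcm m m' : ℕ) := by exact_mod_cast Nat.lcm_pos hm hm'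
  simpa using abs_card_Ioc_filter_modEq_sub_le hab hP t₀

lemma gcd_dvd_sub_of_dvd_add {m m' : ℕ} {t i i' : ℤ} (h : (m : ℤ) ∣ t + i)
    (h' : (m' : ℤ) ∣ t + i') : (Nat.gcd m m' : ℤ) ∣ i' - i := by
  have h1 : (Nat.gcd m m' : ℤ) ∣ t + i :=
    (Int.natCast_dvd_natCast.mpr (Nat.gcd_dvd_left m m')).trans h
  have h2 : (Nat.gcd m m' : ℤ) ∣ t + i' :=
    (Int.natCast_dvd_natCast.mpr (Nat.gcd_dvd_right m m')).trans h'
  have := dvd_sub h2 h1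
  rwa [add_sub_add_left_eq_sub] at this

lemma card_filter_dvd_sub_le (K : ℕ) {g : ℕ} (hg : 0 < g) (i : ℕ) :
    (((Finset.range K).filter (fun i' : ℕ => (g : ℤ) ∣ (i' : ℤ) - i)).card : ℝ) ≤ K / g + 1 := by
  have h := Nat.count_modEq_card_eq_ceil K hg i
  have e : (Finset.range K).filter (fun i' : ℕ => (g : ℤ) ∣ (i' : ℤ) - i) =
      (Finset.range K).filter (fun i' : ℕ => i' ≡ i [MOD g]) := by
    refine Finset.filter_congr fun i' _ => ?_
    rw [Nat.ModEq.comm, Nat.modEq_iff_dvd]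
  rw [Nat.count_eq_card_filter_range] at h
  rw [e]
  have hq : (((Finset.range K).filter (fun i' : ℕ => i' ≡ i [MOD g])).card : ℚ) ≤ K / g + 1 := by
    have h' : (((Finset.range K).filter (fun i' : ℕ => i' ≡ i [MOD g])).card : ℚ) =
        (⌈((K : ℚ) - (i % g : ℕ)) / g⌉ : ℤ) := by exact_mod_cast h
    rw [h']
    refine (Int.ceil_lt_add_one _).le.trans ?_
    have : (0 : ℚ) ≤ (i % g : ℕ) := Nat.cast_nonneg _
    gcongr
    linarith
  have hR := (Rat.cast_le (K := ℝ)).mpr hq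
  push_cast at hR
  exact hR

/-- The number of multiples of `m` among the `K` consecutive integers starting at `t`. -/
def windowCount (K m : ℕ) (t : ℤ) : ℕ :=
  ((Finset.range K).filter (fun i : ℕ => (m : ℤ) ∣ t + i)).card

lemma le_sum_windowCount {a b : ℤ} (hab : a ≤ b) (K : ℕ) {m : ℕ} (hm : 0 < m) :
    K * (((b : ℝ) - a) / m - 1) ≤ ∑ t ∈ Finset.Ioc a b, (windowCount K m t : ℝ) := by
  have h : ∑ t ∈ Finset.Ioc a b, (windowCount K m t : ℝ) = ∑ i ∈ Finset.range K,
      (((Finset.Ioc a b).filter (fun t : ℤ => (m : ℤ) ∣ t + i)).card : ℝ) := by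
    simp only [windowCount, Finset.card_filter, Nat.cast_sum]
    exact Finset.sum_comm
  rw [h, ← Finset.card_range K, ← nsmul_eq_mul, Finset.card_range]
  rw [show K • (((b : ℝ) - a) / m - 1) = (Finset.range K).card • (((b : ℝ) - a) / m - 1) by simp]
  refine Finset.card_nsmul_le_sum _ _ _ fun i _ => ?_
  have := abs_card_filter_dvd_add_sub_le hab hm hm (i := i) (i' := i) (by simp)
  rw [abs_le] at this
  simp only [and_self, Nat.lcm_self] at this
  linarith [this.1]

lemma sum_windowCount_mul_le {a b : ℤ} (hab : a ≤ b) (K : ℕ) {m m' : ℕ} (hm : 0 < m)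
    (hm' : 0 < m') :
    ∑ t ∈ Finset.Ioc a b, (windowCount K m t : ℝ) * windowCount K m' t ≤
      ((b : ℝ) - a) * (K / m * (K / m') + K / (Nat.lcm m m' : ℕ)) + 2 * (K : ℝ) ^ 2 := by
  have h : ∑ t ∈ Finset.Ioc a b, (windowCount K m t : ℝ) * windowCount K m' t =
      ∑ i ∈ Finset.range K, ∑ i' ∈ Finset.range K, (((Finset.Ioc a b).filter
        (fun t : ℤ => (m : ℤ) ∣ t + i ∧ (m' : ℤ) ∣ t + i')).card : ℝ) := by
    simp only [windowCount, Finset.card_filter, Nat.cast_sum, Finset.sum_mul_sum]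
    rw [Finset.sum_comm]
    refine Finset.sum_congr rfl fun i _ => ?_
    rw [Finset.sum_comm]
    refine Finset.sum_congr rfl fun i' _ => Finset.sum_congr rfl fun t _ => ?_
    rw [← Nat.cast_mul, ite_and]
    congr 1
    split_ifs <;> rfl
  have hg : 0 < Nat.gcd m m' := Nat.gcd_pos_of_pos_left _ hm
  have hP : 0 < Nat.lcm m m' := Nat.lcm_pos hm hm'
  set g := Nat.gcd m m' with hgdef
  set P := Nat.lcm m m' with hPdef
  have hgR : (1 : ℝ) ≤ g := by exact_mod_cast hg
  have hPR : (0 : ℝ) < P := by exact_mod_cast hP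
  have hmR : (0 : ℝ) < m := by exact_mod_cast hm
  have hmR' : (0 : ℝ) < m' := by exact_mod_cast hm'
  have hgP : (g : ℝ) * P = m * m' := by exact_mod_cast Nat.gcd_mul_lcm m m'
  have habR : (0 : ℝ) ≤ (b : ℝ) - a := sub_nonneg.mpr (by exact_mod_cast hab)
  have hKK : (K : ℝ) ≤ (K : ℝ) ^ 2 := by exact_mod_cast Nat.le_self_pow two_ne_zero K
  rw [h]
  calc _ ≤ ∑ i ∈ Finset.range K, ∑ i' ∈ Finset.range K,
        if (g : ℤ) ∣ (i' : ℤ) - i then (((b : ℝ) - a) / P + 1) else 0 := by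
        refine Finset.sum_le_sum fun i _ => Finset.sum_le_sum fun i' _ => ?_
        split_ifs with hd
        · have := abs_card_filter_dvd_add_sub_le hab hm hm' hd
          linarith [(abs_le.mp this).2]
        · rw [Finset.filter_eq_empty_iff.mpr]
          · simp
          · exact fun t _ ht => hd (gcd_dvd_sub_of_dvd_add ht.1 ht.2)
    _ = ∑ i ∈ Finset.range K, ((Finset.range K).filter
          (fun i' : ℕ => (g : ℤ) ∣ (i' : ℤ) - i)).card * (((b : ℝ) - a) / P + 1) := by
        refine Finset.sum_congr rfl fun i _ => ?_
        rw [← Finset.sum_filter, Finset.sum_const, nsmul_eq_mul]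
    _ ≤ ∑ i ∈ Finset.range K, ((K : ℝ) / g + 1) * (((b : ℝ) - a) / P + 1) := by
        refine Finset.sum_le_sum fun i _ => ?_
        have := card_filter_dvd_sub_le K hg i
        gcongr
    _ = ((b : ℝ) - a) * (K * K / (g * P) + K / P) + ((K : ℝ) ^ 2 / g + K) := by
        rw [Finset.sum_const, Finset.card_range, nsmul_eq_mul]
        field_simp
    _ ≤ _ := by
        rw [hgP, mul_div_mul_comm]
        have : (K : ℝ) ^ 2 / g ≤ (K : ℝ) ^ 2 := div_le_self (by positivity) hgR
        linarith

/-- A variance bound: a weighted count of the multiples of the moduli `m ∈ S` in a window of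
length `K` is close to its mean `K ∑ D m / m` for most positions of the window. -/
lemma sum_sq_windowCount_sub_mean_le {a b : ℤ} (hab : a ≤ b) (K : ℕ) (S : Finset ℕ)
    (hS : ∀ m ∈ S, 0 < m) (D : ℕ → ℝ) (hD : ∀ m, 0 ≤ D m) :
    ∑ t ∈ Finset.Ioc a b,
        (∑ m ∈ S, D m * windowCount K m t - K * ∑ m ∈ S, D m / m) ^ 2 ≤
      ((b : ℝ) - a) * K * ∑ m ∈ S, ∑ m' ∈ S, D m * D m' / (Nat.lcm m m' : ℕ)
        + 4 * (K : ℝ) ^ 2 * (∑ m ∈ S, D m) ^ 2 := by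
  have habR : (0 : ℝ) ≤ (b : ℝ) - a := sub_nonneg.mpr (by exact_mod_cast hab)
  set lam := ∑ m ∈ S, ∑ m' ∈ S, D m * D m' / (Nat.lcm m m' : ℕ) with hlam
  set σ := ∑ m ∈ S, D m with hσ
  set μ := K * ∑ m ∈ S, D m / m with hμ
  have hμ0 : 0 ≤ μ := mul_nonneg (Nat.cast_nonneg _)
    (Finset.sum_nonneg fun m _ => div_nonneg (hD m) (Nat.cast_nonneg _))
  have hσ0 : 0 ≤ σ := Finset.sum_nonneg fun m _ => hD m
  have hμσ : μ ≤ K * σ := by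
    refine mul_le_mul_of_nonneg_left (Finset.sum_le_sum fun m hm => ?_) (Nat.cast_nonneg _)
    exact div_le_self (hD m) (by exact_mod_cast hS m hm)
  have h1 : ((b : ℝ) - a) * μ - K * σ ≤
      ∑ t ∈ Finset.Ioc a b, ∑ m ∈ S, D m * windowCount K m t := by
    rw [Finset.sum_comm]
    calc ((b : ℝ) - a) * μ - K * σ = ∑ m ∈ S, D m * (K * (((b : ℝ) - a) / m - 1)) := by
          rw [hμ, hσ, Finset.mul_sum, Finset.mul_sum, Finset.mul_sum, ← Finset.sum_sub_distrib]
          exact Finset.sum_congr rfl fun m _ => by ring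
      _ ≤ _ := by
          refine Finset.sum_le_sum fun m hm => ?_
          rw [← Finset.mul_sum]
          exact mul_le_mul_of_nonneg_left (le_sum_windowCount hab K (hS m hm)) (hD m)
  have h2 : ∑ t ∈ Finset.Ioc a b, (∑ m ∈ S, D m * windowCount K m t) ^ 2 ≤
      ((b : ℝ) - a) * (μ ^ 2 + K * lam) + 2 * (K : ℝ) ^ 2 * σ ^ 2 := by
    calc ∑ t ∈ Finset.Ioc a b, (∑ m ∈ S, D m * windowCount K m t) ^ 2
        = ∑ m ∈ S, ∑ m' ∈ S, D m * D m' *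
            ∑ t ∈ Finset.Ioc a b, (windowCount K m t : ℝ) * windowCount K m' t := by
          simp only [sq, Finset.sum_mul_sum]
          simp only [Finset.mul_sum]
          rw [Finset.sum_comm]
          refine Finset.sum_congr rfl fun m _ => ?_
          rw [Finset.sum_comm]
          exact Finset.sum_congr rfl fun m' _ => Finset.sum_congr rfl fun t _ => by ring
      _ ≤ ∑ m ∈ S, ∑ m' ∈ S, D m * D m' * (((b : ℝ) - a) *
            (K / m * (K / m') + K / (Nat.lcm m m' : ℕ)) + 2 * (K : ℝ) ^ 2) := by
          refine Finset.sum_le_sum fun m hm => Finset.sum_le_sum fun m' hm' => ?_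
          exact mul_le_mul_of_nonneg_left (sum_windowCount_mul_le hab K (hS m hm) (hS m' hm'))
            (mul_nonneg (hD m) (hD m'))
      _ = _ := by
          rw [hμ, hlam, hσ]
          simp only [sq, mul_add, Finset.sum_add_distrib, Finset.mul_sum, Finset.sum_mul]
          congr 1
          · congr 1
            · rw [Finset.sum_comm]
              exact Finset.sum_congr rfl fun m _ => Finset.sum_congr rfl fun m' _ => by ring
            · exact Finset.sum_congr rfl fun m _ => Finset.sum_congr rfl fun m' _ => by ring
          · rw [Finset.sum_comm]
            exact Finset.sum_congr rfl fun m _ => Finset.sum_congr rfl fun m' _ => by ring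
  have hcard : ((Finset.Ioc a b).card : ℝ) = (b : ℝ) - a := by
    rw [Int.card_Ioc]
    exact_mod_cast Int.toNat_of_nonneg (sub_nonneg.mpr hab)
  have h3 : ∑ t ∈ Finset.Ioc a b, (∑ m ∈ S, D m * windowCount K m t - μ) ^ 2 =
      ∑ t ∈ Finset.Ioc a b, (∑ m ∈ S, D m * windowCount K m t) ^ 2
        - 2 * μ * ∑ t ∈ Finset.Ioc a b, ∑ m ∈ S, D m * windowCount K m t
        + ((b : ℝ) - a) * μ ^ 2 := by
    rw [← hcard, Finset.mul_sum, ← nsmul_eq_mul, ← Finset.sum_const, ← Finset.sum_sub_distrib,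
      ← Finset.sum_add_distrib]
    exact Finset.sum_congr rfl fun t _ => by ring
  rw [h3]
  have h4 := mul_le_mul_of_nonneg_left h1 (mul_nonneg zero_le_two hμ0)
  have h5 : μ * (K * σ) ≤ (K * σ) * (K * σ) :=
    mul_le_mul_of_nonneg_right hμσ (mul_nonneg (Nat.cast_nonneg _) hσ0)
  nlinarith [h2, h4, h5]

/-! ### Exponential sums over a window -/

lemma expChar_add (x y : ℝ) : expChar (x + y) = expChar x * expChar y := by
  simp only [expChar]
  rw [← Complex.exp_add]
  push_cast
  ring_nf

lemma expChar_intCast (n : ℤ) : expChar n = 1 := by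
  rw [expChar, Complex.exp_eq_one_iff]
  exact ⟨n, by push_cast; ring⟩

lemma norm_expChar (x : ℝ) : ‖expChar x‖ = 1 := by
  rw [expChar, show (2 * Real.pi * Complex.I * x : ℂ) = ((2 * Real.pi * x : ℝ) : ℂ) * Complex.I by
    push_cast; ring]
  exact Complex.norm_exp_ofReal_mul_I _

lemma conj_expChar (x : ℝ) : conj (expChar x) = expChar (-x) := by
  rw [expChar, expChar, ← Complex.exp_conj]
  simp [map_ofNat]

lemma expChar_mul_natCast (x : ℝ) (j : ℕ) : expChar (x * j) = expChar x ^ j := by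
  rw [expChar, expChar, ← Complex.exp_nat_mul]
  push_cast
  ring_nf

/-- If `y` has distance at least `δ` from the integers, then `|e(y) - 1| ≥ 4 δ`: the distance from
`y` to its nearest integer is at most `1 / 2`, where `sin` is bounded below by its chord. -/
lemma le_norm_expChar_sub_one {y δ : ℝ} (h : ∀ n : ℤ, δ ≤ |y - n|) :
    4 * δ ≤ ‖expChar y - 1‖ := by
  set d := y - round y with hd
  have hy : expChar y = expChar d := by
    rw [show y = d + (round y : ℤ) by simp [hd], expChar_add, expChar_intCast, mul_one]
  have hd2 : |d| ≤ 1 / 2 := abs_sub_round y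
  have hπ := Real.pi_pos
  rw [hy, expChar, show (2 * Real.pi * Complex.I * d : ℂ) =
    Complex.I * ((2 * Real.pi * d : ℝ) : ℂ) by push_cast; ring,
    Complex.norm_exp_I_mul_ofReal_sub_one, Real.norm_eq_abs, abs_mul, abs_two,
    show 2 * Real.pi * d / 2 = Real.pi * d by ring]
  have hs : 2 * |d| ≤ |Real.sin (Real.pi * d)| := by
    rw [Real.abs_sin_eq_sin_abs_of_abs_le_pi (by
      rw [abs_mul, abs_of_pos hπ]; nlinarith), abs_mul, abs_of_pos hπ]
    have := Real.mul_le_sin (x := Real.pi * |d|) (by positivity) (by nlinarith)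
    calc 2 * |d| = 2 / Real.pi * (Real.pi * |d|) := by field_simp
      _ ≤ _ := this
  have := h (round y)
  linarith

/-- Multiples of `g` stay away from the integers when multiplied by `α`, as long as `q ∤ g` and
`g` is at most half the quality `Q` of the approximation `a / q` to `α`. -/
lemma one_div_two_mul_le_abs_mul_sub {α Q : ℝ} {a : ℤ} {q g : ℕ} (hq : 0 < q)
    (hQ : 0 < Q) (haq : Int.gcd a q = 1) (hα : |α - (a : ℝ) / (q : ℝ)| < 1 / ((q : ℝ) * Q))
    (hg : (g : ℝ) ≤ Q / 2) (hqg : ¬ q ∣ g) (n : ℤ) :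
    1 / (2 * (q : ℝ)) ≤ |α * g - n| := by
  have hqR : (0 : ℝ) < q := by exact_mod_cast hq
  have hne : a * g - n * q ≠ 0 := by
    intro h
    apply hqg
    have h1 : (q : ℤ) ∣ a * g := ⟨n, by linarith⟩
    exact Int.natCast_dvd_natCast.mp (Int.dvd_of_dvd_mul_right_of_gcd_one h1
      (by rw [Int.gcd_comm]; exact haq))
  have h1 : (1 : ℝ) ≤ |(a : ℝ) * g - n * q| := by
    exact_mod_cast Int.one_le_abs hne
  have h2 : 1 / (q : ℝ) ≤ |(a : ℝ) / q * g - n| := by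
    rw [show (a : ℝ) / q * g - n = (a * g - n * q) / q by field_simp, abs_div, abs_of_pos hqR]
    gcongr
  have h3 : |(α - a / q) * g| ≤ 1 / (2 * (q : ℝ)) := by
    rw [abs_mul, abs_of_nonneg (Nat.cast_nonneg g : (0 : ℝ) ≤ g)]
    calc |α - a / q| * g ≤ 1 / (q * Q) * (Q / 2) := by gcongr
      _ = _ := by field_simp
  have h4 : (a : ℝ) / q * g - n = (α * g - n) - (α - a / q) * g := by ring
  have h5 := abs_sub (α * g - n) ((α - a / q) * g)
  rw [← h4] at h5
  have h6 : 1 / (q : ℝ) = 1 / (2 * q) + 1 / (2 * q) := by field_simp; norm_num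
  linarith

lemma norm_geom_sum_le {z : ℂ} (hz : ‖z‖ = 1) (n : ℕ) {c : ℝ} (hc : 0 < c) (h : c ≤ ‖z - 1‖) :
    ‖∑ j ∈ Finset.range n, z ^ j‖ ≤ 2 / c := by
  have hne : z ≠ 1 := by rintro rfl; simp at h; linarith
  rw [geom_sum_eq hne, norm_div]
  have : ‖z ^ n - 1‖ ≤ 2 := by
    refine (norm_sub_le _ _).trans ?_
    rw [norm_pow, hz, one_pow, norm_one]
    norm_num
  gcongr

/-- Abel summation against a decreasing nonnegative weight. -/
lemma norm_sum_mul_le_of_antitone {w : ℕ → ℝ} (hw : Antitone w) {z : ℕ → ℂ} {n : ℕ} {B : ℝ}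
    (hB : ∀ r ≤ n + 1, ‖∑ j ∈ Finset.range r, z j‖ ≤ B) (hn : 0 ≤ w n) :
    ‖∑ j ∈ Finset.range (n + 1), (w j : ℂ) * z j‖ ≤ w 0 * B := by
  have h := Finset.sum_range_by_parts (fun j => (w j : ℂ)) z (n + 1)
  simp only [smul_eq_mul, Nat.add_sub_cancel] at h
  rw [h]
  refine (norm_sub_le _ _).trans ?_
  have h1 : ‖(w n : ℂ) * ∑ j ∈ Finset.range (n + 1), z j‖ ≤ w n * B := by
    rw [norm_mul, Complex.norm_of_nonneg hn]
    exact mul_le_mul_of_nonneg_left (hB _ le_rfl) hn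
  have h2 : ‖∑ i ∈ Finset.range n, ((w (i + 1) : ℂ) - w i) * ∑ j ∈ Finset.range (i + 1), z j‖ ≤
      ∑ i ∈ Finset.range n, (w i - w (i + 1)) * B := by
    refine norm_sum_le_of_le _ fun i hi => ?_
    have hi' := Finset.mem_range.mp hi
    have : 0 ≤ w i - w (i + 1) := sub_nonneg.mpr (hw (Nat.le_succ i))
    rw [norm_mul, ← Complex.ofReal_sub, Complex.norm_real, norm_sub_rev,
      Real.norm_of_nonneg this]
    exact mul_le_mul_of_nonneg_left (hB _ (by omega)) this
  rw [← Finset.sum_mul, Finset.sum_range_sub'] at h2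
  calc _ ≤ w n * B + (w 0 - w n) * B := add_le_add h1 h2
    _ = _ := by ring

/-- A Toeplitz double sum splits, along its rows above and its columns below the diagonal, into
one-sided sums of `F` starting at `0`. -/
lemma norm_sum_sum_sub_le {F : ℤ → ℂ} {B : ℝ} (K : ℕ)
    (h1 : ∀ n < K, ‖∑ h ∈ Finset.range (n + 1), F h‖ ≤ B)
    (h2 : ∀ n < K, ‖∑ h ∈ Finset.range (n + 1), F (-h)‖ ≤ B) :
    ‖∑ i ∈ Finset.range K, ∑ i' ∈ Finset.range K, F ((i : ℤ) - i')‖ ≤ K * (3 * B) := by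
  induction K with
  | zero => simp
  | succ K ih =>
    have ih' := ih (fun n hn => h1 n (by omega)) (fun n hn => h2 n (by omega))
    have e1 : ∑ i' ∈ Finset.range (K + 1), F ((K : ℤ) - i') =
        ∑ h ∈ Finset.range (K + 1), F h := by
      rw [← Finset.sum_range_reflect]
      refine Finset.sum_congr rfl fun i hi => ?_
      have := Finset.mem_range.mp hi
      congr 1
      omega
    have e2 : ∑ i ∈ Finset.range K, F ((i : ℤ) - K) =
        ∑ h ∈ Finset.range (K + 1), F (-h) - F 0 := by
      rw [Finset.sum_range_succ', Nat.cast_zero, neg_zero, add_sub_cancel_right,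
        ← Finset.sum_range_reflect]
      refine Finset.sum_congr rfl fun i hi => ?_
      have := Finset.mem_range.mp hi
      congr 1
      omega
    have h0 : ‖F 0‖ ≤ B := by simpa using h1 0 (by omega)
    rw [Finset.sum_range_succ, e1]
    simp only [Finset.sum_range_succ (fun i' => F ((_ : ℤ) - i')), Finset.sum_add_distrib]
    rw [e2]
    refine (norm_add_le _ _).trans ?_
    have t1 := norm_add_le (∑ i ∈ Finset.range K, ∑ i' ∈ Finset.range K, F ((i : ℤ) - i'))
      (∑ h ∈ Finset.range (K + 1), F (-h) - F 0)
    have t2 := norm_sub_le (∑ h ∈ Finset.range (K + 1), F (-h)) (F 0)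
    have t3 := h1 K (by omega)
    have t4 := h2 K (by omega)
    push_cast
    linarith

lemma sum_range_ite_dvd {g : ℕ} (hg : 0 < g) (n : ℕ) (f : ℕ → ℂ) :
    ∑ h ∈ Finset.range (n + 1), (if g ∣ h then f h else 0) =
      ∑ j ∈ Finset.range (n / g + 1), f (g * j) := by
  rw [← Finset.sum_filter]
  symm
  refine Finset.sum_bij (fun j _ => g * j) ?_ ?_ ?_ ?_
  · intro j hj
    have := (Nat.le_div_iff_mul_le hg).mp (Nat.lt_succ_iff.mp (Finset.mem_range.mp hj))
    simp only [Finset.mem_filter, Finset.mem_range, dvd_mul_right, and_true]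
    rw [mul_comm] at this
    omega
  · intro j _ j' _ h
    exact Nat.eq_of_mul_eq_mul_left hg h
  · intro h hh
    simp only [Finset.mem_filter, Finset.mem_range] at hh
    obtain ⟨hh, j, rfl⟩ := hh
    refine ⟨j, Finset.mem_range.mpr (Nat.lt_succ_of_le ((Nat.le_div_iff_mul_le hg).mpr ?_)), rfl⟩
    rw [mul_comm]
    omega
  · intros; rfl

/-- Toeplitz sum over a window of the character `e(α h)` at multiples `h` of `g`, with the
triangular weight `W - |h|`. -/
lemma norm_sum_sum_ite_dvd_le (α : ℝ) {g K : ℕ} (hg : 0 < g) {W B : ℝ} (hW : (K : ℝ) - 1 ≤ W)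
    (hB : ∀ r : ℕ, r ≤ K / g + 1 → ‖∑ j ∈ Finset.range r, expChar (α * g) ^ j‖ ≤ B) :
    ‖∑ i ∈ Finset.range K, ∑ i' ∈ Finset.range K, (if (g : ℤ) ∣ (i : ℤ) - i' then
        ((W - |(((i : ℤ) - i' : ℤ) : ℝ)| : ℝ) : ℂ) * expChar (α * ((i : ℤ) - i' : ℤ)) else 0)‖ ≤
      K * (3 * (W * B)) := by
  have hanti : Antitone fun j : ℕ => W - (g * j : ℕ) := by
    intro x y hxy
    have : ((g * x : ℕ) : ℝ) ≤ (g * y : ℕ) := by exact_mod_cast Nat.mul_le_mul_left g hxy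
    simp only
    linarith
  have key : ∀ n < K, ∀ z : ℕ → ℂ,
      (∀ r ≤ n / g + 1, ‖∑ j ∈ Finset.range r, z (g * j)‖ ≤ B) →
      ‖∑ h ∈ Finset.range (n + 1), (if g ∣ h then ((W - (h : ℕ) : ℝ) : ℂ) * z h else 0)‖ ≤
        W * B := by
    intro n hn z hz
    rw [sum_range_ite_dvd hg n (fun h => ((W - (h : ℕ) : ℝ) : ℂ) * z h)]
    have := norm_sum_mul_le_of_antitone hanti (z := fun j => z (g * j)) hz (by
      have h1 : ((g * (n / g) : ℕ) : ℝ) ≤ n := by exact_mod_cast Nat.mul_div_le n g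
      have h2 : (n : ℝ) + 1 ≤ K := by exact_mod_cast hn
      linarith)
    simpa using this
  refine norm_sum_sum_sub_le (F := fun h : ℤ => if (g : ℤ) ∣ h then
    ((W - |(h : ℝ)| : ℝ) : ℂ) * expChar (α * h) else 0) K ?_ ?_
  · intro n hn
    refine le_trans (le_of_eq ?_) (key n hn (fun h => expChar (α * h)) ?_)
    · congr 1
      refine Finset.sum_congr rfl fun h _ => ?_
      simp [Int.natCast_dvd_natCast]
    · intro r hr
      refine le_trans (le_of_eq ?_)
        (hB r (hr.trans (Nat.add_le_add_right (Nat.div_le_div_right hn.le) 1)))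
      congr 1
      refine Finset.sum_congr rfl fun j _ => ?_
      rw [← expChar_mul_natCast]
      push_cast
      ring_nf
  · intro n hn
    refine le_trans (le_of_eq ?_) (key n hn (fun h => expChar (-(α * h))) ?_)
    · congr 1
      refine Finset.sum_congr rfl fun h _ => ?_
      simp [Int.natCast_dvd_natCast]
    · intro r hr
      refine le_trans (le_of_eq ?_)
        (hB r (hr.trans (Nat.add_le_add_right (Nat.div_le_div_right hn.le) 1)))
      rw [← Complex.norm_conj (∑ j ∈ Finset.range r, expChar (α * g) ^ j), map_sum]
      congr 1
      refine Finset.sum_congr rfl fun j _ => ?_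
      rw [← expChar_mul_natCast, conj_expChar]
      push_cast
      ring_nf

/-- The exponential sum over the multiples of `m` in `(U, V]` among the `K` consecutive integers
starting at `t`. -/
noncomputable def windowSum (α : ℝ) (U V : ℤ) (K m : ℕ) (t : ℤ) : ℂ :=
  ∑ i ∈ Finset.range K, if (m : ℤ) ∣ t + i ∧ t + i ∈ Finset.Ioc U V then
    expChar (α * (t + i : ℤ)) else 0

lemma norm_windowSum_le (α : ℝ) (U V : ℤ) (K m : ℕ) (t : ℤ) :
    ‖windowSum α U V K m t‖ ≤ windowCount K m t := by
  rw [windowSum, windowCount, Finset.card_filter, Nat.cast_sum]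
  refine norm_sum_le_of_le _ fun i _ => ?_
  split_ifs with h h' h'
  · simp [norm_expChar]
  · exact absurd h.1 h'
  · simp
  · simp

/-- Correlation of the sums over multiples of `m` and of `m'`, over all positions of the window:
it is governed by the geometric sums with ratio `e(α gcd(m, m'))`. -/
lemma norm_sum_windowSum_mul_conj_le (α : ℝ) {U V a b : ℤ} {K m m' : ℕ} (ha : a + K ≤ U)
    (hb : V ≤ b) (hUV : (K : ℤ) - 1 ≤ V - U) (hm : 0 < m) (hm' : 0 < m') {B : ℝ}
    (hB : ∀ r : ℕ, r ≤ K / Nat.gcd m m' + 1 →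
      ‖∑ j ∈ Finset.range r, expChar (α * Nat.gcd m m') ^ j‖ ≤ B) :
    ‖∑ t ∈ Finset.Ioc a b, windowSum α U V K m t * conj (windowSum α U V K m' t)‖ ≤
      3 * K * ((V : ℝ) - U) * B / (Nat.lcm m m' : ℕ) + (K : ℝ) ^ 2 := by
  have hg : 0 < Nat.gcd m m' := Nat.gcd_pos_of_pos_left _ hm
  have hP : 0 < Nat.lcm m m' := Nat.lcm_pos hm hm'
  set g := Nat.gcd m m' with hgdef
  set P := Nat.lcm m m' with hPdef
  have hPR : (0 : ℝ) < P := by exact_mod_cast hP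
  set W : ℝ := (V : ℝ) - U with hWdef
  have hW : (K : ℝ) - 1 ≤ W := by rw [hWdef]; exact_mod_cast hUV
  set c : ℕ → ℕ → ℝ := fun i i' => (((Finset.Ioc (U - min (i : ℤ) i') (V - max (i : ℤ) i')).filter
    (fun t : ℤ => (m : ℤ) ∣ t + i ∧ (m' : ℤ) ∣ t + i')).card : ℝ) with hc
  set M : ℕ → ℕ → ℂ := fun i i' => if (g : ℤ) ∣ (i : ℤ) - i' then
        ((W - |(((i : ℤ) - i' : ℤ) : ℝ)| : ℝ) : ℂ) * expChar (α * ((i : ℤ) - i' : ℤ)) else 0 with hM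
  have hexp : ∑ t ∈ Finset.Ioc a b, windowSum α U V K m t * conj (windowSum α U V K m' t) =
      ∑ i ∈ Finset.range K, ∑ i' ∈ Finset.range K,
        (c i i' : ℂ) * expChar (α * ((i : ℤ) - i' : ℤ)) := by
    simp only [windowSum, map_sum, Finset.sum_mul_sum]
    rw [Finset.sum_comm]
    refine Finset.sum_congr rfl fun i hi => ?_
    rw [Finset.sum_comm]
    refine Finset.sum_congr rfl fun i' hi' => ?_
    have hi := Finset.mem_range.mp hi
    have hi' := Finset.mem_range.mp hi'
    have hfil : (Finset.Ioc (U - min (i : ℤ) i') (V - max (i : ℤ) i')).filter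
        (fun t : ℤ => (m : ℤ) ∣ t + i ∧ (m' : ℤ) ∣ t + i') =
        (Finset.Ioc a b).filter (fun t : ℤ => ((m : ℤ) ∣ t + i ∧ t + i ∈ Finset.Ioc U V) ∧
          ((m' : ℤ) ∣ t + i' ∧ t + i' ∈ Finset.Ioc U V)) := by
      ext t
      simp only [Finset.mem_filter, Finset.mem_Ioc]
      constructor
      · rintro ⟨⟨h1, h2⟩, h3, h4⟩
        refine ⟨⟨by omega, by omega⟩, ⟨h3, by omega, by omega⟩, h4, by omega, by omega⟩
      · rintro ⟨_, ⟨h3, h5, h6⟩, h4, h7, h8⟩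
        exact ⟨⟨by omega, by omega⟩, h3, h4⟩
    simp only [hc]
    rw [hfil, Finset.card_filter]
    push_cast
    rw [Finset.sum_mul]
    refine Finset.sum_congr rfl fun t _ => ?_
    by_cases hA : (m : ℤ) ∣ t + i ∧ t + i ∈ Finset.Ioc U V
    · by_cases hA' : (m' : ℤ) ∣ t + i' ∧ t + i' ∈ Finset.Ioc U V
      · rw [if_pos hA, if_pos hA', if_pos (And.intro hA hA'), Complex.ofReal_one, one_mul,
          conj_expChar, ← expChar_add]
        congr 1
        ring
      · rw [if_neg hA', if_neg (not_and_of_not_right _ hA'), map_zero, mul_zero,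
          Complex.ofReal_zero, zero_mul]
    · rw [if_neg hA, if_neg (not_and_of_not_left _ hA), Complex.ofReal_zero, zero_mul, zero_mul]
  have happrox : ∀ i ∈ Finset.range K, ∀ i' ∈ Finset.range K,
      ‖(c i i' : ℂ) * expChar (α * ((i : ℤ) - i' : ℤ)) - M i i' / P‖ ≤ 1 := by
    intro i hi i' hi'
    have hi := Finset.mem_range.mp hi
    have hi' := Finset.mem_range.mp hi'
    simp only [hM]
    split_ifs with hd
    · have h1 := abs_card_filter_dvd_add_sub_le (a := U - min (i : ℤ) i') (b := V - max (i : ℤ) i')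
        (by omega) hm hm' (i := i) (i' := i') (by rw [← dvd_neg, neg_sub]; exact hd)
      have h2 : ((V - max (i : ℤ) i' : ℤ) : ℝ) - (U - min (i : ℤ) i' : ℤ) =
          W - |(((i : ℤ) - i' : ℤ) : ℝ)| := by
        have : (max (i : ℤ) i') - min (i : ℤ) i' = |(i : ℤ) - i'| := max_sub_min_eq_abs' _ _
        rw [← Int.cast_abs, ← this, hWdef]
        push_cast
        ring
      rw [h2] at h1
      rw [mul_div_right_comm, ← sub_mul, norm_mul, norm_expChar, mul_one]
      calc _ = ‖((c i i' - (W - |(((i : ℤ) - i' : ℤ) : ℝ)|) / P : ℝ) : ℂ)‖ := by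
            push_cast; rfl
        _ ≤ 1 := by rw [Complex.norm_real]; exact h1
    · have h0 : c i i' = 0 := by
        simp only [hc]
        rw [Finset.filter_eq_empty_iff.mpr]
        · simp
        · intro t _ ht
          apply hd
          rw [← dvd_neg, neg_sub]
          exact gcd_dvd_sub_of_dvd_add ht.1 ht.2
      simp [h0]
  have hmain := norm_sum_sum_ite_dvd_le α hg hW hB
  have hsplit : ∑ i ∈ Finset.range K, ∑ i' ∈ Finset.range K,
        (c i i' : ℂ) * expChar (α * ((i : ℤ) - i' : ℤ)) =
      ∑ i ∈ Finset.range K, ∑ i' ∈ Finset.range K,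
        ((c i i' : ℂ) * expChar (α * ((i : ℤ) - i' : ℤ)) - M i i' / P) +
      (∑ i ∈ Finset.range K, ∑ i' ∈ Finset.range K, M i i') / P := by
    simp only [Finset.sum_div, ← Finset.sum_add_distrib, sub_add_cancel]
  rw [hexp, hsplit]
  refine (norm_add_le _ _).trans ?_
  rw [add_comm]
  refine add_le_add ?_ ?_
  · rw [norm_div, Complex.norm_natCast]
    calc _ ≤ K * (3 * (W * B)) / P := by gcongr
      _ = _ := by ring
  · calc _ ≤ ∑ i ∈ Finset.range K, ∑ i' ∈ Finset.range K, (1 : ℝ) :=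
          norm_sum_le_of_le _ fun i hi => norm_sum_le_of_le _ fun i' hi' => happrox i hi i' hi'
      _ = _ := by simp [sq]

/-- Second moment, over all positions of the window, of a weighted sum over moduli not divisible
by `q`. For two such moduli, `g = gcd(m, m')` is not divisible by `q` either, so the geometric sum
with ratio `e(α g)` is at most `q` if `g ≤ Q / 2`; for larger `g` it has few terms. -/
lemma sum_norm_sq_windowSum_le {α Q : ℝ} {a₀ : ℤ} {q : ℕ} (hq : 0 < q)
    (hQ : 0 < Q) (haq : Int.gcd a₀ q = 1) (hα : |α - (a₀ : ℝ) / (q : ℝ)| < 1 / ((q : ℝ) * Q))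
    {U V a b : ℤ} {K : ℕ} (ha : a + K ≤ U) (hb : V ≤ b) (hUV : (K : ℤ) - 1 ≤ V - U)
    (hUV0 : U ≤ V) (S : Finset ℕ)
    (hS : ∀ m ∈ S, 0 < m) (hSq : ∀ m ∈ S, ¬ q ∣ m) (D : ℕ → ℝ) (hD : ∀ m, 0 ≤ D m) :
    ∑ t ∈ Finset.Ioc a b, ‖∑ m ∈ S, (D m : ℂ) * windowSum α U V K m t‖ ^ 2 ≤
      3 * K * ((V : ℝ) - U) * (q + 2 * K / Q + 1) *
        ∑ m ∈ S, ∑ m' ∈ S, D m * D m' / (Nat.lcm m m' : ℕ)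
        + (K : ℝ) ^ 2 * (∑ m ∈ S, D m) ^ 2 := by
  have hqR : (0 : ℝ) < q := by exact_mod_cast hq
  have hW : (0 : ℝ) ≤ (V : ℝ) - U := sub_nonneg.mpr (by exact_mod_cast hUV0)
  set B : ℝ := q + 2 * K / Q + 1 with hBdef
  have hgeom : ∀ m ∈ S, ∀ m' ∈ S, ∀ r : ℕ, r ≤ K / Nat.gcd m m' + 1 →
      ‖∑ j ∈ Finset.range r, expChar (α * Nat.gcd m m') ^ j‖ ≤ B := by
    intro m hm m' hm' r hr
    have hg : 0 < Nat.gcd m m' := Nat.gcd_pos_of_pos_left _ (hS m hm)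
    have hqg : ¬ q ∣ Nat.gcd m m' := fun h => hSq m hm (h.trans (Nat.gcd_dvd_left _ _))
    set g := Nat.gcd m m'
    have hgR : (0 : ℝ) < g := by exact_mod_cast hg
    rcases le_or_gt (g : ℝ) (Q / 2) with hgQ | hgQ
    · have h1 := le_norm_expChar_sub_one
        (one_div_two_mul_le_abs_mul_sub hq hQ haq hα hgQ hqg)
      have h2 := norm_geom_sum_le (norm_expChar (α * g)) r (c := 4 * (1 / (2 * (q : ℝ))))
        (by positivity) h1
      have h3 : 2 / (4 * (1 / (2 * (q : ℝ)))) = q := by field_simp; norm_num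
      rw [h3] at h2
      have : 0 ≤ 2 * K / Q := by positivity
      linarith
    · have h1 : ‖∑ j ∈ Finset.range r, expChar (α * g) ^ j‖ ≤ r := by
        refine (norm_sum_le_of_le _ (f := fun j => expChar (α * g) ^ j)
          (n := fun _ => (1 : ℝ)) fun j _ => ?_).trans (by simp)
        rw [norm_pow, norm_expChar, one_pow]
      have h2 : (r : ℝ) ≤ K / g + 1 := by
        calc (r : ℝ) ≤ ((K / g + 1 : ℕ) : ℝ) := by exact_mod_cast hr
          _ ≤ _ := by push_cast; gcongr; exact Nat.cast_div_le
      have h3 : (K : ℝ) / g ≤ 2 * K / Q := by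
        rw [div_le_div_iff₀ hgR hQ]
        have : (0 : ℝ) ≤ K := Nat.cast_nonneg K
        nlinarith
      linarith
  -- expand the square and sum over the position of the window first
  have hsq : ((∑ t ∈ Finset.Ioc a b, ‖∑ m ∈ S, (D m : ℂ) * windowSum α U V K m t‖ ^ 2 : ℝ) : ℂ) =
      ∑ m ∈ S, ∑ m' ∈ S, ((D m * D m' : ℝ) : ℂ) *
        ∑ t ∈ Finset.Ioc a b, windowSum α U V K m t * conj (windowSum α U V K m' t) := by
    push_cast
    simp only [← Complex.mul_conj', map_sum, map_mul, Complex.conj_ofReal, Finset.sum_mul_sum]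
    simp only [Finset.mul_sum]
    rw [Finset.sum_comm]
    refine Finset.sum_congr rfl fun m _ => ?_
    rw [Finset.sum_comm]
    exact Finset.sum_congr rfl fun m' _ => Finset.sum_congr rfl fun t _ => by ring
  calc ∑ t ∈ Finset.Ioc a b, ‖∑ m ∈ S, (D m : ℂ) * windowSum α U V K m t‖ ^ 2
      = ‖((∑ t ∈ Finset.Ioc a b,
          ‖∑ m ∈ S, (D m : ℂ) * windowSum α U V K m t‖ ^ 2 : ℝ) : ℂ)‖ := by
        rw [Complex.norm_of_nonneg (Finset.sum_nonneg fun _ _ => by positivity)]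
    _ ≤ ∑ m ∈ S, ∑ m' ∈ S, (D m * D m') *
          (3 * K * ((V : ℝ) - U) * B / (Nat.lcm m m' : ℕ) + (K : ℝ) ^ 2) := by
        rw [hsq]
        refine norm_sum_le_of_le _ fun m hm => norm_sum_le_of_le _ fun m' hm' => ?_
        have h0 := mul_nonneg (hD m) (hD m')
        rw [norm_mul, Complex.norm_of_nonneg h0]
        exact mul_le_mul_of_nonneg_left (norm_sum_windowSum_mul_conj_le α ha hb hUV (hS m hm)
          (hS m' hm') (hgeom m hm m' hm')) h0
    _ = _ := by
        simp only [mul_add, Finset.sum_add_distrib]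
        congr 1
        · simp only [Finset.mul_sum]
          exact Finset.sum_congr rfl fun m _ => Finset.sum_congr rfl fun m' _ => by ring
        · rw [sq (∑ m ∈ S, D m), Finset.sum_mul_sum]
          simp only [Finset.mul_sum]
          exact Finset.sum_congr rfl fun m _ => Finset.sum_congr rfl fun m' _ => by ring

/-! ### The exceptional set -/

lemma card_filter_lt_mul_sq_le (s : Finset ℤ) (f : ℤ → ℝ) {c : ℝ} (hc : 0 ≤ c) :
    ((s.filter fun t => c < |f t|).card : ℝ) * c ^ 2 ≤ ∑ t ∈ s, f t ^ 2 := by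
  calc ((s.filter fun t => c < |f t|).card : ℝ) * c ^ 2
      = ∑ t ∈ s.filter fun t => c < |f t|, c ^ 2 := by rw [Finset.sum_const, nsmul_eq_mul]
    _ ≤ ∑ t ∈ s.filter fun t => c < |f t|, f t ^ 2 := by
        refine Finset.sum_le_sum fun t ht => ?_
        rw [← sq_abs (f t)]
        have := (Finset.mem_filter.mp ht).2
        gcongr
    _ ≤ ∑ t ∈ s, f t ^ 2 :=
        Finset.sum_le_sum_of_subset_of_nonneg (Finset.filter_subset _ _) fun _ _ _ => sq_nonneg _

/-- Outside few positions of the window, the weighted exponential sum is bounded by the mean value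
of the contribution of the moduli divisible by `q`, up to an error of size `H / Q ^ (1 / 8)`. -/
lemma exists_bad_positions {α Q X H : ℝ} {a₀ : ℤ} {q K : ℕ} (hX : 3 ≤ X) (hH : 1 ≤ H)
    (hHX : H ≤ X) (hQH : Q ^ 2 ≤ H) (hq : 0 < q) (hqQ : (q : ℝ) ≤ Q)
    (haq : Int.gcd a₀ q = 1) (hα : |α - (a₀ : ℝ) / (q : ℝ)| < 1 / ((q : ℝ) * Q))
    (hK : K = ⌊H⌋₊ ∨ K = ⌊H⌋₊ + 1) (S : Finset ℕ) (hS : ∀ m ∈ S, 0 < m)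
    (D : ℕ → ℝ) (hD : ∀ m, 0 ≤ D m) {lam σ : ℝ}
    (hlam : ∑ m ∈ S, ∑ m' ∈ S, D m * D m' / (Nat.lcm m m' : ℕ) ≤ lam)
    (hσ : ∑ m ∈ S, D m ≤ σ) :
    ∃ bad : Finset ℤ, (bad.card : ℝ) ≤ (80 * X * lam / Q + 20 * σ ^ 2) * Q ^ (1 / 4 : ℝ) ∧
      ∀ t : ℤ, 1 ≤ t → (t : ℝ) ≤ 2 * X + 1 → t ∉ bad →
        ‖∑ m ∈ S, (D m : ℂ) * windowSum α ⌊X⌋ ⌊2 * X⌋ K m t‖ ≤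
          2 * (H / Q ^ (1 / 8 : ℝ)) + K * ∑ m ∈ S with q ∣ m, D m / m := by
  have hq1 : (1 : ℝ) ≤ q := by exact_mod_cast hq
  have hQ1 : 1 ≤ Q := hq1.trans hqQ
  have hQ0 : 0 < Q := by linarith
  have hH0 : 0 < H := by linarith
  have hKH : (K : ℝ) ≤ H + 1 := by
    have := Nat.floor_le hH0.le
    rcases hK with h | h <;> rw [h] <;> push_cast <;> linarith
  have hK2 : (K : ℝ) ≤ 2 * H := by linarith
  have hK0 : (0 : ℝ) ≤ K := Nat.cast_nonneg K
  set U := ⌊X⌋ with hU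
  set V := ⌊2 * X⌋ with hV
  have hU1 := Int.floor_le X
  have hU2 := Int.lt_floor_add_one X
  have hV1 := Int.floor_le (2 * X)
  have hU0 : 0 ≤ U := Int.floor_nonneg.mpr (by linarith)
  have hUV2 : 2 * U ≤ V := Int.le_floor.mpr (by push_cast; linarith)
  have hHU : (⌊H⌋₊ : ℤ) ≤ U := Int.le_floor.mpr (by
    have := Nat.floor_le hH0.le
    push_cast
    linarith)
  have hUV : (K : ℤ) - 1 ≤ V - U := by
    rcases hK with h | h <;> rw [h] <;> push_cast <;> omega
  have hW : ((V : ℝ) - U) ≤ 2 * X := by linarith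
  have hW0 : 0 ≤ ((V : ℝ) - U) := sub_nonneg.mpr (by exact_mod_cast (by omega : U ≤ V))
  set c := H / Q ^ (1 / 8 : ℝ) with hc
  have hc0 : 0 < c := by positivity
  set S₁ := S.filter (fun m => ¬ q ∣ m) with hS₁
  set S₂ := S.filter (fun m => q ∣ m) with hS₂
  have hsub : ∀ T ⊆ S, (∑ m ∈ T, ∑ m' ∈ T, D m * D m' / (Nat.lcm m m' : ℕ) ≤ lam) ∧
      (∑ m ∈ T, D m) ^ 2 ≤ σ ^ 2 := by
    intro T hT
    have hnn : ∀ m m', 0 ≤ D m * D m' / (Nat.lcm m m' : ℕ) := fun m m' =>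
      div_nonneg (mul_nonneg (hD m) (hD m')) (Nat.cast_nonneg _)
    constructor
    · refine le_trans ?_ hlam
      refine (Finset.sum_le_sum fun m _ =>
        Finset.sum_le_sum_of_subset_of_nonneg hT fun m' _ _ => hnn m m').trans ?_
      exact Finset.sum_le_sum_of_subset_of_nonneg hT fun m _ _ =>
        Finset.sum_nonneg fun m' _ => hnn m m'
    · have h1 : 0 ≤ ∑ m ∈ T, D m := Finset.sum_nonneg fun m _ => hD m
      have h2 : ∑ m ∈ T, D m ≤ σ :=
        (Finset.sum_le_sum_of_subset_of_nonneg hT fun m _ _ => hD m).trans hσ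
      gcongr
  have hlam0 : 0 ≤ lam := le_trans (by simp) (hsub ∅ (Finset.empty_subset S)).1
  set f₁ : ℤ → ℝ := fun t => ‖∑ m ∈ S₁, (D m : ℂ) * windowSum α U V K m t‖ with hf₁
  set f₂ : ℤ → ℝ := fun t => ∑ m ∈ S₂, D m * windowCount K m t - K * ∑ m ∈ S₂, D m / m with hf₂
  -- contains every position at which the window meets `(X, 2X]`, and every `t` in the claim
  set J := Finset.Ioc (-(K : ℤ)) (V + 1) with hJ
  -- `Q ^ 2 ≤ H` makes `H ^ 2 / Q` the dominant term in both moments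
  have hQH' : Q ≤ H / Q := by rw [le_div_iff₀ hQ0]; linarith [sq Q]
  have hHQ : H ≤ H ^ 2 / Q := by
    rw [le_div_iff₀ hQ0, sq]
    have : Q ≤ H := by nlinarith
    gcongr
  have hm₁ : ∑ t ∈ J, f₁ t ^ 2 ≤ H ^ 2 * (72 * X * lam / Q + 4 * σ ^ 2) := by
    have hbase := sum_norm_sq_windowSum_le hq hQ0 haq hα (U := U) (V := V) (a := -(K : ℤ))
      (b := V + 1) (K := K) (by omega) (by omega) hUV (by omega) S₁
      (fun m hm => hS m (Finset.mem_filter.mp hm).1) (fun m hm => (Finset.mem_filter.mp hm).2) D hD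
    obtain ⟨h1, h2⟩ := hsub S₁ (Finset.filter_subset _ _)
    have h3 : (q : ℝ) + 2 * K / Q + 1 ≤ 6 * (H / Q) := by
      have : 2 * K / Q ≤ 4 * (H / Q) := by
        rw [← mul_div_assoc]
        exact div_le_div_of_nonneg_right (by linarith) hQ0.le
      linarith
    calc _ ≤ _ := hbase
      _ ≤ 3 * (2 * H) * (2 * X) * (6 * (H / Q)) * lam + (2 * H) ^ 2 * σ ^ 2 := by
          gcongr
          exact Finset.sum_nonneg fun m _ => Finset.sum_nonneg fun m' _ =>
            div_nonneg (mul_nonneg (hD m) (hD m')) (Nat.cast_nonneg _)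
      _ = _ := by ring
  have hm₂ : ∑ t ∈ J, f₂ t ^ 2 ≤ H ^ 2 * (8 * X * lam / Q + 16 * σ ^ 2) := by
    have hbase := sum_sq_windowCount_sub_mean_le (a := -(K : ℤ)) (b := V + 1) (by omega) K S₂
      (fun m hm => hS m (Finset.mem_filter.mp hm).1) D hD
    obtain ⟨h1, h2⟩ := hsub S₂ (Finset.filter_subset _ _)
    have h3 : ((V + 1 : ℤ) : ℝ) - (-(K : ℤ) : ℤ) ≤ 4 * X := by push_cast; linarith
    calc _ ≤ _ := hbase
      _ ≤ 4 * X * (2 * H) * lam + 4 * (2 * H) ^ 2 * σ ^ 2 := by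
          gcongr
          exact Finset.sum_nonneg fun m _ => Finset.sum_nonneg fun m' _ =>
            div_nonneg (mul_nonneg (hD m) (hD m')) (Nat.cast_nonneg _)
      _ = 8 * X * lam * H + 16 * H ^ 2 * σ ^ 2 := by ring
      _ ≤ 8 * X * lam * (H ^ 2 / Q) + 16 * H ^ 2 * σ ^ 2 := by gcongr
      _ = _ := by ring
  refine ⟨(J.filter fun t => c < |f₁ t|) ∪ (J.filter fun t => c < |f₂ t|), ?_, ?_⟩
  · have h1 := card_filter_lt_mul_sq_le J f₁ hc0.le
    have h2 := card_filter_lt_mul_sq_le J f₂ hc0.le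
    have h3 : (((J.filter fun t => c < |f₁ t|) ∪ (J.filter fun t => c < |f₂ t|)).card : ℝ) ≤
        ((J.filter fun t => c < |f₁ t|).card : ℝ) + (J.filter fun t => c < |f₂ t|).card := by
      exact_mod_cast Finset.card_union_le _ _
    have hcsq : c ^ 2 * Q ^ (1 / 4 : ℝ) = H ^ 2 := by
      have : (Q ^ (1 / 8 : ℝ)) ^ 2 = Q ^ (1 / 4 : ℝ) := by
        rw [← Real.rpow_natCast, ← Real.rpow_mul hQ0.le]
        norm_num
      rw [hc, div_pow, this, div_mul_cancel₀]
      positivity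
    have h4 := mul_le_mul_of_nonneg_right h3 (sq_nonneg c)
    have h5 : (((J.filter fun t => c < |f₁ t|) ∪ (J.filter fun t => c < |f₂ t|)).card : ℝ) * c ^ 2
        ≤ ((80 * X * lam / Q + 20 * σ ^ 2) * Q ^ (1 / 4 : ℝ)) * c ^ 2 := by
      calc _ ≤ H ^ 2 * (72 * X * lam / Q + 4 * σ ^ 2) + H ^ 2 * (8 * X * lam / Q + 16 * σ ^ 2) := by
            linarith
        _ = (80 * X * lam / Q + 20 * σ ^ 2) * H ^ 2 := by ring
        _ = _ := by rw [← hcsq]; ring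
    exact le_of_mul_le_mul_right h5 (by positivity)
  · intro t ht1 ht2 htbad
    have htJ : t ∈ J := by
      rw [hJ, Finset.mem_Ioc]
      refine ⟨by omega, ?_⟩
      have : t - 1 ≤ V := Int.le_floor.mpr (by push_cast; linarith)
      omega
    simp only [Finset.mem_union, Finset.mem_filter, htJ, true_and, not_or, not_lt] at htbad
    obtain ⟨hb1, hb2⟩ := htbad
    have hsplit : ∑ m ∈ S, (D m : ℂ) * windowSum α U V K m t =
        ∑ m ∈ S₂, (D m : ℂ) * windowSum α U V K m t +
        ∑ m ∈ S₁, (D m : ℂ) * windowSum α U V K m t :=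
      (Finset.sum_filter_add_sum_filter_not S _ _).symm
    have h2 : ‖∑ m ∈ S₂, (D m : ℂ) * windowSum α U V K m t‖ ≤
        ∑ m ∈ S₂, D m * windowCount K m t := by
      refine norm_sum_le_of_le _ fun m _ => ?_
      rw [norm_mul, Complex.norm_of_nonneg (hD m)]
      exact mul_le_mul_of_nonneg_left (norm_windowSum_le α U V K m t) (hD m)
    have h3 := (le_abs_self _).trans hb1
    have h4 := (le_abs_self _).trans hb2
    simp only [hf₁, hf₂] at h3 h4
    rw [hsplit]
    refine (norm_add_le _ _).trans ?_
    linarith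

/-- The moduli `m` occurring in the truncated divisor sum. -/
noncomputable def truncModuli (k : ℕ) (ε' X : ℝ) : Finset ℕ :=
  (Finset.Icc 1 ⌊truncLevel k X⌋₊).filter fun m =>
    (ArithmeticFunction.cardFactors m : ℝ) ≤ (1 + ε') * k * Real.log (Real.log X)

lemma truncDivisor_eq {k : ℕ} {ε' X : ℝ} (hX : 0 ≤ X) (n : ℕ) :
    truncDivisor k ε' X n = ∑ m ∈ truncModuli k ε' X,
      if (m : ℤ) ∣ (n : ℤ) ∧ (n : ℤ) ∈ Finset.Ioc ⌊X⌋ ⌊2 * X⌋ then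
        (divisorFun (k - 1) m : ℝ) else 0 := by
  have hM : 0 ≤ truncLevel k X := Real.rpow_nonneg hX _
  have hiff : (n : ℤ) ∈ Finset.Ioc ⌊X⌋ ⌊2 * X⌋ ↔ X < (n : ℝ) ∧ (n : ℝ) ≤ 2 * X := by
    rw [Finset.mem_Ioc, Int.floor_lt, Int.le_floor]
    simp
  rw [truncDivisor]
  split_ifs with h
  · have hn : n ≠ 0 := by
      rintro rfl
      have := h.1
      simp at this
      linarith
    simp only [hiff, h, and_self, and_true, Int.natCast_dvd_natCast]
    rw [← Finset.sum_filter]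
    refine Finset.sum_congr ?_ fun _ _ => rfl
    ext m
    simp only [truncModuli, Finset.mem_filter, Nat.mem_divisors, Finset.mem_Icc,
      Nat.le_floor_iff hM]
    constructor
    · rintro ⟨⟨h1, _⟩, h2, h3⟩
      exact ⟨⟨⟨Nat.pos_of_dvd_of_pos h1 (Nat.pos_of_ne_zero hn), h2⟩, h3⟩, h1⟩
    · rintro ⟨⟨⟨_, h2⟩, h3⟩, h1⟩
      exact ⟨⟨h1, hn⟩, h2, h3⟩
  · simp [hiff, h]

/-- The short exponential sum depends on `x` only through `⌈x⌉` and the number `K` of integers in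
`[x, x + H]`. -/
lemma shortExpSum_eq {k : ℕ} {ε' X H α x : ℝ} (hX : 0 ≤ X) (hx : 0 ≤ x) (hH : 0 ≤ H) :
    ∃ K : ℕ, (K = ⌊H⌋₊ ∨ K = ⌊H⌋₊ + 1) ∧ shortExpSum k ε' X H α x =
      ∑ m ∈ truncModuli k ε' X, ((divisorFun (k - 1) m : ℝ) : ℂ) *
        windowSum α ⌊X⌋ ⌊2 * X⌋ K m ⌈x⌉ := by
  have h1 := Nat.ceil_lt_add_one hx
  have h2 := Nat.le_ceil x
  have h3 := Nat.floor_le (add_nonneg hx hH)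
  have h4 := Nat.lt_floor_add_one (x + H)
  have h5 := Nat.floor_le hH
  have h6 := Nat.lt_floor_add_one H
  have hle : ⌈x⌉₊ ≤ ⌊x + H⌋₊ + 1 := Nat.ceil_le.mpr (by push_cast; linarith)
  refine ⟨⌊x + H⌋₊ + 1 - ⌈x⌉₊, ?_, ?_⟩
  · have h7 : ⌊x + H⌋₊ + 1 < ⌊H⌋₊ + ⌈x⌉₊ + 2 := by
      have : ((⌊x + H⌋₊ + 1 : ℕ) : ℝ) < (⌊H⌋₊ + ⌈x⌉₊ + 2 : ℕ) := by push_cast; linarith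
      exact_mod_cast this
    have h8 : ⌊H⌋₊ + ⌈x⌉₊ < ⌊x + H⌋₊ + 2 := by
      have : ((⌊H⌋₊ + ⌈x⌉₊ : ℕ) : ℝ) < (⌊x + H⌋₊ + 2 : ℕ) := by push_cast; linarith
      exact_mod_cast this
    omega
  · rw [shortExpSum, ← Finset.Ico_add_one_right_eq_Icc, Finset.sum_Ico_eq_sum_range]
    simp only [windowSum, Finset.mul_sum]
    rw [Finset.sum_comm]
    refine Finset.sum_congr rfl fun i _ => ?_
    rw [truncDivisor_eq hX]
    push_cast
    rw [Finset.sum_mul]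
    refine Finset.sum_congr rfl fun m _ => ?_
    have hceil : ((⌈x⌉₊ : ℕ) : ℤ) = ⌈x⌉ := Int.natCast_ceil_eq_ceil hx
    have hceil' : ((⌈x⌉₊ : ℕ) : ℝ) = (⌈x⌉ : ℤ) := by rw [← hceil]; simp
    rw [hceil, hceil']
    split_ifs <;> simp

/-- The points whose ceiling lies in a finite set of integers form a set of small measure. -/
lemma exists_measurableSet_of_bad (bad : Finset ℤ) (u v : ℝ) :
    ∃ E : Set ℝ, MeasurableSet E ∧ E ⊆ Set.Icc u v ∧ volume E ≤ ENNReal.ofReal bad.card ∧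
      ∀ x ∈ Set.Icc u v \ E, ⌈x⌉ ∉ bad := by
  refine ⟨Set.Icc u v ∩ Int.ceil ⁻¹' (bad : Set ℤ), ?_, Set.inter_subset_left, ?_, ?_⟩
  · exact measurableSet_Icc.inter (Int.measurable_ceil bad.measurableSet)
  · calc volume (Set.Icc u v ∩ Int.ceil ⁻¹' (bad : Set ℤ))
        ≤ volume (⋃ t ∈ bad, Set.Ioc ((t : ℝ) - 1) t) := by
          refine measure_mono fun x hx => ?_
          have hx2 : ⌈x⌉ ∈ bad := hx.2
          refine Set.mem_biUnion hx2 ⟨?_, Int.le_ceil x⟩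
          linarith [Int.ceil_lt_add_one x]
      _ ≤ ∑ t ∈ bad, volume (Set.Ioc ((t : ℝ) - 1) t) := measure_biUnion_finset_le _ _
      _ = ENNReal.ofReal bad.card := by
          simp [Real.volume_Ioc]
  · intro x hx hbad
    exact hx.2 ⟨hx.1, hbad⟩

lemma sum_filter_dvd_divisorFun_div_le (j N : ℕ) {q : ℕ} (hq : 0 < q) (S : Finset ℕ)
    (hS : S ⊆ Finset.Icc 1 N) :
    ∑ m ∈ S with q ∣ m, (divisorFun j m : ℝ) / m ≤
      (divisorFun j q : ℝ) / q * (1 + Real.log N) ^ j := by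
  calc ∑ m ∈ S with q ∣ m, (divisorFun j m : ℝ) / m
      ≤ ∑ m ∈ (Finset.Icc 1 N).image (fun u => q * u), (divisorFun j m : ℝ) / m := by
        refine Finset.sum_le_sum_of_subset_of_nonneg ?_ fun _ _ _ => by positivity
        intro m hm
        obtain ⟨hmS, u, rfl⟩ := Finset.mem_filter.mp hm
        obtain ⟨h1, h2⟩ := Finset.mem_Icc.mp (hS hmS)
        refine Finset.mem_image.mpr ⟨u, Finset.mem_Icc.mpr ⟨?_, ?_⟩, rfl⟩
        · exact Nat.pos_of_mul_pos_left (a := q) h1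
        · exact (Nat.le_mul_of_pos_left u hq).trans h2
    _ = ∑ u ∈ Finset.Icc 1 N, (divisorFun j (q * u) : ℝ) / (q * u : ℕ) :=
        Finset.sum_image fun u _ v _ h => Nat.eq_of_mul_eq_mul_left hq h
    _ ≤ ∑ u ∈ Finset.Icc 1 N, (divisorFun j q : ℝ) / q * ((divisorFun j u : ℝ) / u) := by
        refine Finset.sum_le_sum fun u _ => ?_
        rw [div_mul_div_comm]
        push_cast
        gcongr
        exact_mod_cast divisorFun_mul_le j q u
    _ ≤ _ := by
        rw [← Finset.mul_sum]
        gcongr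
        exact sum_divisorFun_div_le j N

/-! ### Logarithmic estimates -/

/-- The divisor bound along `q ≤ (log X) ^ A`, in the form `d_j(q) ≤ (log X) ^ o(1)`. -/
lemma exists_exponent_divisorFun_le (j : ℕ) {A : ℝ} (hA : 0 ≤ A) :
    ∃ η : ℝ → ℝ, Tendsto η atTop (𝓝 0) ∧ ∀ X : ℝ, 0 < Real.log X →
      1 ≤ Real.log (Real.log X) → 0 ≤ η X ∧
      ∀ q : ℕ, 0 < q → (q : ℝ) ≤ Real.log X ^ A → (divisorFun j q : ℝ) ≤ Real.log X ^ η X := by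
  -- the exponent is chosen so that `(log X) ^ η X` is the maximum of `d_j(q)` over the range
  set N : ℝ → ℕ := fun X => max 1 ((Finset.Icc 1 ⌊Real.log X ^ A⌋₊).sup (divisorFun j)) with hN
  have hN1 : ∀ X, (1 : ℝ) ≤ N X := fun X => by exact_mod_cast le_max_left _ _
  refine ⟨fun X => Real.log (N X) / Real.log (Real.log X), ?_, ?_⟩
  · have hLL : Tendsto (fun X => Real.log (Real.log X)) atTop atTop :=
      Real.tendsto_log_atTop.comp Real.tendsto_log_atTop
    rw [Metric.tendsto_nhds]
    intro δ hδ
    have hA1 : 0 < A + 1 := by linarith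
    obtain ⟨C, hC1, hC⟩ := exists_divisorFun_le_rpow j (δ := δ / (2 * (A + 1))) (by positivity)
    filter_upwards [hLL.eventually_ge_atTop 1,
      hLL.eventually_gt_atTop (2 * Real.log C / δ), Real.tendsto_log_atTop.eventually_gt_atTop 0]
      with X h1 h2 h3
    have hNle : (N X : ℝ) ≤ C * Real.log X ^ (A * (δ / (2 * (A + 1)))) := by
      have hone : (1 : ℝ) ≤ Real.log X := by
        have := Real.log_le_sub_one_of_pos h3
        linarith
      have hbig : (1 : ℝ) ≤ C * Real.log X ^ (A * (δ / (2 * (A + 1)))) :=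
        one_le_mul_of_one_le_of_one_le hC1 (Real.one_le_rpow hone (by positivity))
      rw [hN]
      simp only [Nat.cast_max, Nat.cast_one]
      refine max_le hbig ?_
      rcases Finset.eq_empty_or_nonempty (Finset.Icc 1 ⌊Real.log X ^ A⌋₊) with he | hne
      · rw [he]
        simp only [Finset.sup_empty, bot_eq_zero', Nat.cast_zero]
        linarith
      · obtain ⟨q, hq, hqe⟩ := Finset.exists_mem_eq_sup _ hne (divisorFun j)
        rw [hqe]
        obtain ⟨hq1, hq2⟩ := Finset.mem_Icc.mp hq
        have hq3 : (q : ℝ) ≤ Real.log X ^ A :=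
          (Nat.le_floor_iff (Real.rpow_nonneg h3.le _)).mp hq2
        refine (hC q (by omega)).trans ?_
        rw [Real.rpow_mul h3.le]
        gcongr
    have hlogN : Real.log (N X) ≤
        Real.log C + A * (δ / (2 * (A + 1))) * Real.log (Real.log X) := by
      calc Real.log (N X) ≤ Real.log (C * Real.log X ^ (A * (δ / (2 * (A + 1))))) :=
            Real.log_le_log (by linarith [hN1 X]) hNle
        _ = _ := by
            rw [Real.log_mul (by linarith) (Real.rpow_pos_of_pos h3 _).ne', Real.log_rpow h3]
    have hhalf : A * (δ / (2 * (A + 1))) ≤ δ / 2 := by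
      rw [← mul_div_assoc, div_le_div_iff₀ (by positivity) (by positivity)]
      nlinarith
    rw [Real.dist_eq, sub_zero, abs_of_nonneg
      (div_nonneg (Real.log_nonneg (hN1 X)) (by linarith)), div_lt_iff₀ (by linarith)]
    rw [div_lt_iff₀ hδ] at h2
    have h4 := mul_le_mul_of_nonneg_right hhalf (by linarith : 0 ≤ Real.log (Real.log X))
    linarith
  · intro X h3 hX
    refine ⟨div_nonneg (Real.log_nonneg (hN1 X)) (by linarith), fun q hq hqA => ?_⟩
    have h4 : Real.log X ^ (Real.log (N X) / Real.log (Real.log X)) = N X := by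
      rw [Real.rpow_def_of_pos h3, mul_div_cancel₀ _ (by linarith), Real.exp_log]
      linarith [hN1 X]
    rw [h4]
    have : divisorFun j q ≤ N X :=
      (Finset.le_sup (f := divisorFun j) (Finset.mem_Icc.mpr
        ⟨hq, (Nat.le_floor_iff (Real.rpow_nonneg h3.le _)).mpr hqA⟩)).trans (le_max_right _ _)
    exact_mod_cast this

lemma divisorFun_le_rpow_of_mem_truncModuli {k : ℕ} (hk : 1 ≤ k) {ε' X : ℝ} (hε' : ε' < 1)
    (hL : 0 < Real.log X) (hLL : 0 ≤ Real.log (Real.log X)) {m : ℕ} (hm : m ∈ truncModuli k ε' X) :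
    (divisorFun (k - 1) m : ℝ) ≤ Real.log X ^ (2 * (k : ℝ) * Real.log k) := by
  obtain ⟨hm1, hm2⟩ := Finset.mem_filter.mp hm
  have hm0 : m ≠ 0 := by have := (Finset.mem_Icc.mp hm1).1; omega
  have hk0 : (0 : ℝ) < k := by exact_mod_cast hk
  have hlogk : 0 ≤ Real.log k := Real.log_natCast_nonneg k
  have h1 : (divisorFun (k - 1) m : ℝ) ≤ (k : ℝ) ^ ArithmeticFunction.cardFactors m := by
    exact_mod_cast (divisorFun_le_pow_cardFactors (k - 1) hm0).trans
      (Nat.pow_le_pow_left (Nat.sub_le k 1) _)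
  refine h1.trans ?_
  rw [← Real.rpow_natCast, Real.rpow_def_of_pos hk0, Real.rpow_def_of_pos hL]
  apply Real.exp_le_exp.mpr
  have h2 : (ArithmeticFunction.cardFactors m : ℝ) ≤ 2 * k * Real.log (Real.log X) := by
    refine hm2.trans ?_
    gcongr
    linarith
  calc Real.log k * (ArithmeticFunction.cardFactors m : ℝ)
      ≤ Real.log k * (2 * k * Real.log (Real.log X)) := by gcongr
    _ = _ := by ring

lemma one_add_log_floor_truncLevel_le {k : ℕ} {X : ℝ} (hX : 1 ≤ X) (hL : 1 ≤ Real.log X)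
    (hLL : 1 ≤ Real.log (Real.log X)) :
    1 + Real.log ⌊truncLevel k X⌋₊ ≤ (2 * k + 1) * Real.log X := by
  have h1 : 1 ≤ truncLevel k X := Real.one_le_rpow hX (by positivity)
  have h2 : Real.log ⌊truncLevel k X⌋₊ ≤ Real.log (truncLevel k X) :=
    Real.log_le_log (by exact_mod_cast Nat.floor_pos.mpr h1) (Nat.floor_le (by linarith))
  have h3 : Real.log (truncLevel k X) = 2 * k / Real.log (Real.log X) * Real.log X :=
    Real.log_rpow (by linarith) _
  have h4 : 2 * (k : ℝ) / Real.log (Real.log X) ≤ 2 * k := div_le_self (by positivity) hLL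
  have h5 := mul_le_mul_of_nonneg_right h4 (by linarith : 0 ≤ Real.log X)
  linarith

/-- For `k = 1` only the modulus `1` carries weight; for `k ≥ 2` the loss of a power of `log X`
is absorbed by `Q ^ (1 / 2)`. -/
lemma sum_divisorFun_mul_div_lcm_le {k : ℕ} (hk : 1 ≤ k) {ε' X Q : ℝ} (hε' : ε' < 1)
    (hX : 1 ≤ X) (hL : (2 * (k : ℝ) + 1) ^ 3 ≤ Real.log X) (hLL : 1 ≤ Real.log (Real.log X))
    (hQ1 : 1 ≤ Q) (hQ : Real.log X ^ (12 * (k : ℝ) * Real.log k) ≤ Q) :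
    ∑ m ∈ truncModuli k ε' X, ∑ m' ∈ truncModuli k ε' X,
      (divisorFun (k - 1) m : ℝ) * divisorFun (k - 1) m' / (Nat.lcm m m' : ℕ) ≤
      Q ^ (1 / 2 : ℝ) * Real.log X ^ (3 * (k : ℝ) * Real.log k) := by
  have hk1 : (1 : ℝ) ≤ k := by exact_mod_cast hk
  have hL1 : 1 ≤ Real.log X := le_trans (one_le_pow₀ (by linarith)) hL
  have hL0 : 0 < Real.log X := by linarith
  rcases Nat.eq_or_lt_of_le hk with rfl | hk2
  · have h1 : ∑ m ∈ truncModuli 1 ε' X, ∑ m' ∈ truncModuli 1 ε' X,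
        (divisorFun (1 - 1) m : ℝ) * divisorFun (1 - 1) m' / (Nat.lcm m m' : ℕ) ≤ 1 := by
      calc _ ≤ ∑ m ∈ truncModuli 1 ε' X, ∑ m' ∈ truncModuli 1 ε' X,
            (if m = 1 then (1 : ℝ) else 0) * (if m' = 1 then 1 else 0) := by
            refine Finset.sum_le_sum fun m _ => Finset.sum_le_sum fun m' _ => ?_
            simp only [Nat.sub_self, divisorFun_zero_left]
            split_ifs with h h' <;> simp [h]
            simp [h']
        _ = (∑ m ∈ truncModuli 1 ε' X, if m = 1 then (1 : ℝ) else 0) ^ 2 := by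
            rw [sq, Finset.sum_mul_sum]
        _ ≤ 1 := by
            rw [Finset.sum_ite_eq']
            split_ifs <;> norm_num
    have h2 : 1 ≤ Q ^ (1 / 2 : ℝ) := Real.one_le_rpow hQ1 (by norm_num)
    simpa using h1.trans h2
  · have hlogk : (1 / 2 : ℝ) ≤ Real.log k := by
      have h2k : (2 : ℝ) ≤ k := by exact_mod_cast hk2
      have := Real.log_le_log (by norm_num) h2k
      linarith [Real.log_two_gt_d9]
    have hk2R : (2 : ℝ) ≤ k := by exact_mod_cast hk2
    have hlogk2 : (4 : ℝ) ≤ 5 * k * Real.log k := by nlinarith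
    have hlogN : 0 ≤ Real.log ⌊truncLevel k X⌋₊ := Real.log_natCast_nonneg _
    set L := Real.log X with hLdef
    set Y := L ^ (2 * (k : ℝ) * Real.log k) with hY
    have hY0 : 0 ≤ Y := Real.rpow_nonneg hL0.le _
    have hDY : ∀ m ∈ truncModuli k ε' X, (divisorFun (k - 1) m : ℝ) ≤ Y := fun m hm =>
      divisorFun_le_rpow_of_mem_truncModuli hk hε' hL0 (by linarith) hm
    calc _ ≤ ∑ m ∈ truncModuli k ε' X, ∑ m' ∈ truncModuli k ε' X,
          Y * Y * (1 / (Nat.lcm m m' : ℕ)) := by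
          refine Finset.sum_le_sum fun m hm => Finset.sum_le_sum fun m' hm' => ?_
          rw [div_eq_mul_one_div]
          have := hDY m hm
          have := hDY m' hm'
          gcongr
      _ ≤ ∑ m ∈ Finset.Icc 1 ⌊truncLevel k X⌋₊, ∑ m' ∈ Finset.Icc 1 ⌊truncLevel k X⌋₊,
          Y * Y * (1 / (Nat.lcm m m' : ℕ)) := by
          have hsub : truncModuli k ε' X ⊆ Finset.Icc 1 ⌊truncLevel k X⌋₊ :=
            Finset.filter_subset _ _
          refine (Finset.sum_le_sum fun m _ => Finset.sum_le_sum_of_subset_of_nonneg hsub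
            fun _ _ _ => by positivity).trans ?_
          exact Finset.sum_le_sum_of_subset_of_nonneg hsub fun _ _ _ => by positivity
      _ = Y * Y * ∑ m ∈ Finset.Icc 1 ⌊truncLevel k X⌋₊, ∑ m' ∈ Finset.Icc 1 ⌊truncLevel k X⌋₊,
          1 / (Nat.lcm m m' : ℝ) := by simp only [Finset.mul_sum]
      _ ≤ Y * Y * L ^ (4 : ℝ) := by
          gcongr
          refine (sum_one_div_lcm_le _).trans ?_
          calc (1 + Real.log ⌊truncLevel k X⌋₊) ^ 3 ≤ ((2 * k + 1) * L) ^ 3 := by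
                gcongr
                exact one_add_log_floor_truncLevel_le hX hL1 hLL
            _ = (2 * (k : ℝ) + 1) ^ 3 * L ^ 3 := by ring
            _ ≤ L * L ^ 3 := by gcongr
            _ = L ^ (4 : ℝ) := by norm_cast; ring
      _ = L ^ (4 * (k : ℝ) * Real.log k + 4) := by
          rw [hY, ← Real.rpow_add hL0, ← Real.rpow_add hL0]
          ring_nf
      _ ≤ L ^ (12 * (k : ℝ) * Real.log k * (1 / 2) + 3 * (k : ℝ) * Real.log k) := by
          apply Real.rpow_le_rpow_of_exponent_le hL1
          linarith
      _ = (L ^ (12 * (k : ℝ) * Real.log k)) ^ (1 / 2 : ℝ) * L ^ (3 * (k : ℝ) * Real.log k) := by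
          rw [Real.rpow_add hL0, Real.rpow_mul hL0.le]
      _ ≤ _ := by gcongr

lemma sum_truncModuli_divisorFun_le {k : ℕ} (hk : 1 ≤ k) {ε' X : ℝ} (hε' : ε' < 1)
    (hX : 0 ≤ X) (hL : 0 < Real.log X) (hLL : 0 ≤ Real.log (Real.log X)) :
    ∑ m ∈ truncModuli k ε' X, (divisorFun (k - 1) m : ℝ) ≤
      truncLevel k X * Real.log X ^ (2 * (k : ℝ) * Real.log k) := by
  calc _ ≤ ∑ m ∈ truncModuli k ε' X, Real.log X ^ (2 * (k : ℝ) * Real.log k) :=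
        Finset.sum_le_sum fun m hm => divisorFun_le_rpow_of_mem_truncModuli hk hε' hL hLL hm
    _ = (truncModuli k ε' X).card * Real.log X ^ (2 * (k : ℝ) * Real.log k) := by
        rw [Finset.sum_const, nsmul_eq_mul]
    _ ≤ _ := by
        gcongr
        calc ((truncModuli k ε' X).card : ℝ) ≤ (⌊truncLevel k X⌋₊ : ℝ) := by
              have := Finset.card_filter_le (Finset.Icc 1 ⌊truncLevel k X⌋₊) fun m =>
                (ArithmeticFunction.cardFactors m : ℝ) ≤ (1 + ε') * k * Real.log (Real.log X)
              rw [Nat.card_Icc, Nat.add_sub_cancel] at this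
              exact_mod_cast this
          _ ≤ _ := Nat.floor_le (Real.rpow_nonneg hX _)

/-- The truncation level is `X ^ o(1)`, so its square times a power of `log X` is below `X`. -/
lemma eventually_truncLevel_sq_mul_le (k : ℕ) (B : ℝ) :
    ∀ᶠ X : ℝ in atTop, truncLevel k X ^ 2 * Real.log X ^ B ≤ X := by
  have hL : Tendsto Real.log atTop atTop := Real.tendsto_log_atTop
  have hLL : Tendsto (fun X => Real.log (Real.log X)) atTop atTop := hL.comp hL
  have hlo := ((Real.isLittleO_log_id_atTop.comp_tendsto hL).bound
    (show (0 : ℝ) < 1 / (2 * (|B| + 1)) by positivity))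
  filter_upwards [hLL.eventually_ge_atTop (8 * k + 1), hL.eventually_gt_atTop 0,
    eventually_gt_atTop 0, hlo] with X h1 h2 h3 h4
  simp only [Function.comp, id] at h4
  have hk : (0 : ℝ) ≤ k := Nat.cast_nonneg k
  have h5 : 0 < Real.log (Real.log X) := by linarith
  rw [Real.norm_of_nonneg h5.le, Real.norm_of_nonneg h2.le, div_mul_eq_mul_div, one_mul,
    le_div_iff₀ (by positivity)] at h4
  have h6 : Real.log (Real.log X) * B ≤ Real.log X / 2 := by
    have : Real.log (Real.log X) * B ≤ Real.log (Real.log X) * (|B| + 1) := by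
      gcongr
      linarith [le_abs_self B]
    linarith
  have h7 : Real.log X * (2 * k / Real.log (Real.log X)) * 2 ≤ Real.log X / 2 := by
    have : 2 * (k : ℝ) / Real.log (Real.log X) ≤ 1 / 4 := by
      rw [div_le_div_iff₀ h5 (by norm_num)]
      linarith
    nlinarith
  rw [truncLevel, Real.rpow_def_of_pos h3, Real.rpow_def_of_pos h2, ← Real.exp_nat_mul,
    ← Real.exp_add]
  calc _ ≤ Real.exp (Real.log X) := by
        apply Real.exp_le_exp.mpr
        push_cast
        linarith
    _ = X := Real.exp_log h3

/-! ### The exponential sum of the truncated divisor function -/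

theorem mainTheorem3 (k : ℕ) (hk : 1 ≤ k) :
    ∃ C : ℝ, 0 < C ∧ ∃ η : ℝ → ℝ, Tendsto η atTop (𝓝 0) ∧
      ∀ ε ε' X H₁ Q₁ : ℝ, 0 < ε → 0 < ε' → ε' < 1 → 3 ≤ X → H₁ ≤ X →
        Real.log X ^ (10 * (k : ℝ) * Real.log k) ≤ H₁ →
        Q₁ ≤ min (H₁ ^ (2 / 5 : ℝ) / Real.log X ^ ((1 + 2 * ε) * (k : ℝ) * Real.log k))
          (Real.log X ^ (10000 * (k : ℝ) ^ 10)) →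
        ∀ (α : ℝ) (a : ℤ) (q : ℕ), 0 < q → (q : ℝ) ≤ Q₁ → Int.gcd a q = 1 →
          |α - (a : ℝ) / (q : ℝ)| < 1 / ((q : ℝ) * Q₁) →
          ∃ E : Set ℝ, MeasurableSet E ∧ E ⊆ Set.Icc (X / 2) (2 * X) ∧
            volume E ≤ ENNReal.ofReal
              (C * (X * Real.log X ^ (3 * (k : ℝ) * Real.log k) / Q₁ ^ (1 / 4 : ℝ))) ∧
            ∀ x ∈ Set.Icc (X / 2) (2 * X) \ E,
              ‖shortExpSum k ε' X H₁ α x‖ ≤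
                C * ((1 / (q : ℝ) + 1 / Q₁ ^ (1 / 8 : ℝ)) * H₁ *
                  Real.log X ^ ((k : ℝ) - 1 + η X)) := by
  have hk1 : (1 : ℝ) ≤ k := by exact_mod_cast hk
  have hlogk : 0 ≤ Real.log k := Real.log_natCast_nonneg k
  set A : ℝ := 10000 * (k : ℝ) ^ 10 with hA
  have hA0 : 0 ≤ A := by positivity
  obtain ⟨η, hη, hηq⟩ := exists_exponent_divisorFun_le (k - 1) hA0
  obtain ⟨X₀, hX₀⟩ := eventually_atTop.mp
    (((Real.tendsto_log_atTop.comp Real.tendsto_log_atTop).eventually_ge_atTop 1).and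
      ((Real.tendsto_log_atTop.eventually_ge_atTop ((2 * (k : ℝ) + 1) ^ 3)).and
        (eventually_truncLevel_sq_mul_le k (4 * k * Real.log k + A / 2))))
  set R : ℝ := Real.log (max X₀ 3) ^ (A / 4) with hR
  have hlog3 : 1 ≤ Real.log 3 := by
    rw [Real.le_log_iff_exp_le (by norm_num)]
    linarith [Real.exp_one_lt_d9]
  have hR0 : 0 < R := Real.rpow_pos_of_pos
    (by linarith [Real.log_le_log (by norm_num) (le_max_right X₀ 3)]) _
  refine ⟨2 * R + 2 * (2 * (k : ℝ) + 1) ^ (k - 1) + 200, by positivity, η, hη, ?_⟩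
  set C : ℝ := 2 * R + 2 * (2 * (k : ℝ) + 1) ^ (k - 1) + 200 with hC
  have hC1 : 2 * (2 * (k : ℝ) + 1) ^ (k - 1) ≤ C := by rw [hC]; linarith
  have hC2 : 200 ≤ C := by
    have : 0 ≤ 2 * (2 * (k : ℝ) + 1) ^ (k - 1) := by positivity
    rw [hC]; linarith
  have hC3 : 2 * R ≤ C := by
    have : 0 ≤ 2 * (2 * (k : ℝ) + 1) ^ (k - 1) := by positivity
    rw [hC]; linarith
  intro ε ε' X H Q hε _ hε' hX hHX hH hQ α a q hq hqQ haq hα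
  have hX0 : 0 < X := by linarith
  set L := Real.log X with hLdef
  have hL1 : 1 ≤ L := hlog3.trans (Real.log_le_log (by norm_num) hX)
  have hL0 : 0 < L := by linarith
  set Y := L ^ (3 * (k : ℝ) * Real.log k) with hY
  have hY1 : 1 ≤ Y := Real.one_le_rpow hL1 (by positivity)
  have hH1 : 1 ≤ H := (Real.one_le_rpow hL1 (by positivity)).trans hH
  have hq1 : (1 : ℝ) ≤ q := by exact_mod_cast hq
  have hQ1 : 1 ≤ Q := hq1.trans hqQ
  have hQ0 : 0 < Q := by linarith
  have hQA : Q ≤ L ^ A := hQ.trans (min_le_right _ _)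
  have hQH : Q ^ 2 ≤ H := by
    have h1 : Q ≤ H ^ (2 / 5 : ℝ) := (hQ.trans (min_le_left _ _)).trans
      (div_le_self (by positivity) (Real.one_le_rpow hL1 (by positivity)))
    calc Q ^ 2 ≤ (H ^ (2 / 5 : ℝ)) ^ 2 := by gcongr
      _ = H ^ (4 / 5 : ℝ) := by
        rw [← Real.rpow_natCast, ← Real.rpow_mul (by linarith)]
        norm_num
      _ ≤ H ^ (1 : ℝ) := Real.rpow_le_rpow_of_exponent_le hH1 (by norm_num)
      _ = H := Real.rpow_one H
  -- for bounded `X`, and for `Q` at most `(log X) ^ (12 k log k)`, every point may be exceptional.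
  by_cases htriv : X < X₀ ∨ Q ^ (1 / 4 : ℝ) ≤ Y
  · refine ⟨Set.Icc (X / 2) (2 * X), measurableSet_Icc, subset_rfl, ?_, by simp⟩
    rw [Real.volume_Icc]
    apply ENNReal.ofReal_le_ofReal
    have hQpos : 0 < Q ^ (1 / 4 : ℝ) := by positivity
    have hkey : 2 * Q ^ (1 / 4 : ℝ) ≤ C * Y := by
      rcases htriv with h | h
      · have h1 : Q ^ (1 / 4 : ℝ) ≤ R := by
          calc Q ^ (1 / 4 : ℝ) ≤ (L ^ A) ^ (1 / 4 : ℝ) := by gcongr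
            _ = L ^ (A / 4) := by rw [← Real.rpow_mul hL0.le]; ring_nf
            _ ≤ R := by
              exact Real.rpow_le_rpow hL0.le
                (Real.log_le_log hX0 (h.le.trans (le_max_left X₀ 3))) (by positivity)
        calc 2 * Q ^ (1 / 4 : ℝ) ≤ 2 * R := by linarith
          _ ≤ C := hC3
          _ ≤ C * Y := le_mul_of_one_le_right (by linarith) hY1
      · exact mul_le_mul (by linarith) h hQpos.le (by linarith)
    rw [← mul_div_assoc, le_div_iff₀ hQpos]
    nlinarith
  push Not at htriv
  obtain ⟨hXX₀, hQY⟩ := htriv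
  obtain ⟨hLL, hLk, hM⟩ := hX₀ X hXX₀
  simp only [Function.comp] at hLL
  have hQ12 : L ^ (12 * (k : ℝ) * Real.log k) ≤ Q := by
    calc L ^ (12 * (k : ℝ) * Real.log k) = Y ^ 4 := by
          rw [hY, ← Real.rpow_natCast, ← Real.rpow_mul hL0.le]
          push_cast
          ring_nf
      _ ≤ (Q ^ (1 / 4 : ℝ)) ^ 4 := by gcongr
      _ = Q := by
          rw [← Real.rpow_natCast, ← Real.rpow_mul hQ0.le]
          norm_num
  set D : ℕ → ℝ := fun m => (divisorFun (k - 1) m : ℝ) with hD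
  have hD0 : ∀ m, 0 ≤ D m := fun m => Nat.cast_nonneg _
  set S := truncModuli k ε' X with hS
  have hS0 : ∀ m ∈ S, 0 < m := fun m hm => by
    have := (Finset.mem_Icc.mp (Finset.mem_filter.mp hm).1).1
    omega
  have hlam := sum_divisorFun_mul_div_lcm_le hk hε' (by linarith) hLk hLL hQ1 hQ12
  have hσ := sum_truncModuli_divisorFun_le hk hε' hX0.le hL0 (by linarith)
  set σ := truncLevel k X * L ^ (2 * (k : ℝ) * Real.log k) with hσdef
  have hσQ : σ ^ 2 * Q ^ (1 / 2 : ℝ) ≤ X := by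
    calc σ ^ 2 * Q ^ (1 / 2 : ℝ) ≤ σ ^ 2 * (L ^ A) ^ (1 / 2 : ℝ) := by gcongr
      _ = truncLevel k X ^ 2 * L ^ (4 * (k : ℝ) * Real.log k + A / 2) := by
          rw [hσdef, mul_pow, mul_assoc, ← Real.rpow_natCast (L ^ _), ← Real.rpow_mul hL0.le,
            ← Real.rpow_mul hL0.le, ← Real.rpow_add hL0]
          push_cast
          ring_nf
      _ ≤ X := hM
  -- the window has `⌊H⌋` or `⌊H⌋ + 1` integers; the bad positions are collected for both lengths
  have hbad : ∀ K : ℕ, (K = ⌊H⌋₊ ∨ K = ⌊H⌋₊ + 1) → ∃ bad : Finset ℤ,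
      (bad.card : ℝ) ≤ 100 * (X * Y / Q ^ (1 / 4 : ℝ)) ∧
      ∀ t : ℤ, 1 ≤ t → (t : ℝ) ≤ 2 * X + 1 → t ∉ bad →
        ‖∑ m ∈ S, (D m : ℂ) * windowSum α ⌊X⌋ ⌊2 * X⌋ K m t‖ ≤
          2 * (H / Q ^ (1 / 8 : ℝ)) + K * ∑ m ∈ S with q ∣ m, D m / m := by
    intro K hK
    obtain ⟨bad, hcard, hb⟩ := exists_bad_positions hX hH1 hHX hQH hq hqQ haq hα hK S hS0 D hD0
      hlam hσ
    refine ⟨bad, hcard.trans ?_, hb⟩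
    have e1 : Q ^ (1 / 2 : ℝ) * Q ^ (1 / 2 : ℝ) = Q := by
      rw [← Real.rpow_add hQ0]; norm_num
    have e2 : Q ^ (1 / 4 : ℝ) * Q ^ (1 / 4 : ℝ) = Q ^ (1 / 2 : ℝ) := by
      rw [← Real.rpow_add hQ0]; norm_num
    set w := Q ^ (1 / 4 : ℝ) with hw
    have hw0 : 0 < w := by positivity
    rw [← e2] at e1 hσQ ⊢
    rw [← mul_div_assoc, le_div_iff₀ hw0]
    have e3 : 80 * X * (w * w * Y) / Q = 80 * X * Y / (w * w) := by
      rw [← e1]; field_simp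
    rw [e3]
    calc (80 * X * Y / (w * w) + 20 * σ ^ 2) * w * w
        = 80 * (X * Y) + 20 * (σ ^ 2 * (w * w)) := by field_simp
      _ ≤ 80 * (X * Y) + 20 * (X * Y) := by
          have : X ≤ X * Y := le_mul_of_one_le_right hX0.le hY1
          linarith
      _ = 100 * (X * Y) := by ring
  obtain ⟨bad₀, hcard₀, hb₀⟩ := hbad ⌊H⌋₊ (Or.inl rfl)
  obtain ⟨bad₁, hcard₁, hb₁⟩ := hbad (⌊H⌋₊ + 1) (Or.inr rfl)
  obtain ⟨E, hEm, hEsub, hEvol, hE⟩ :=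
    exists_measurableSet_of_bad (bad₀ ∪ bad₁) (X / 2) (2 * X)
  refine ⟨E, hEm, hEsub, hEvol.trans (ENNReal.ofReal_le_ofReal ?_), ?_⟩
  · have h1 : ((bad₀ ∪ bad₁).card : ℝ) ≤ bad₀.card + bad₁.card := by
      exact_mod_cast Finset.card_union_le _ _
    have h2 : 0 ≤ X * Y / Q ^ (1 / 4 : ℝ) := by positivity
    have h3 := mul_le_mul_of_nonneg_right hC2 h2
    linarith
  intro x hx
  have hxbad := hE x hx
  rw [Finset.mem_union, not_or] at hxbad
  obtain ⟨hx1, hx2⟩ := hx.1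
  have hx0 : 0 < x := by linarith
  obtain ⟨K, hK, hsum⟩ := shortExpSum_eq (k := k) (ε' := ε') (α := α) hX0.le hx0.le
    (show 0 ≤ H by linarith)
  have hKH : (K : ℝ) ≤ 2 * H := by
    have := Nat.floor_le (show 0 ≤ H by linarith)
    rcases hK with h | h <;> rw [h] <;> push_cast <;> linarith
  have ht1 : 1 ≤ ⌈x⌉ := Int.one_le_ceil_iff.mpr hx0
  have ht2 : (⌈x⌉ : ℝ) ≤ 2 * X + 1 := by linarith [Int.ceil_lt_add_one x]
  have hS' : ‖shortExpSum k ε' X H α x‖ ≤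
      2 * (H / Q ^ (1 / 8 : ℝ)) + K * ∑ m ∈ S with q ∣ m, D m / m := by
    rw [hsum]
    rcases hK with rfl | rfl
    · exact hb₀ _ ht1 ht2 hxbad.1
    · exact hb₁ _ ht1 ht2 hxbad.2
  obtain ⟨hη0, hηd⟩ := hηq X hL0 hLL
  have hmain : ∑ m ∈ S with q ∣ m, D m / m ≤
      L ^ η X / q * ((2 * k + 1) ^ (k - 1) * L ^ (k - 1)) := by
    refine (sum_filter_dvd_divisorFun_div_le (k - 1) _ hq S (Finset.filter_subset _ _)).trans ?_
    have h1 := hηd q hq (hqQ.trans hQA)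
    have h2 := one_add_log_floor_truncLevel_le (k := k) (by linarith : 1 ≤ X) hL1 hLL
    have h3 : 0 ≤ Real.log ⌊truncLevel k X⌋₊ := Real.log_natCast_nonneg _
    rw [← mul_pow]
    gcongr
  have hpow : L ^ ((k : ℝ) - 1 + η X) = L ^ (k - 1) * L ^ η X := by
    rw [Real.rpow_add hL0, ← Real.rpow_natCast, Nat.cast_sub hk, Nat.cast_one]
  set Z := L ^ ((k : ℝ) - 1 + η X) with hZ
  have hZ1 : 1 ≤ Z := Real.one_le_rpow hL1 (by linarith)
  have hH0 : 0 < H := by linarith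
  calc ‖shortExpSum k ε' X H α x‖
      ≤ 2 * (H / Q ^ (1 / 8 : ℝ)) + K * ∑ m ∈ S with q ∣ m, D m / m := hS'
    _ ≤ 2 * (H / Q ^ (1 / 8 : ℝ)) * Z +
        2 * H * (L ^ η X / q * ((2 * k + 1) ^ (k - 1) * L ^ (k - 1))) := by
        refine add_le_add (le_mul_of_one_le_right (by positivity) hZ1) ?_
        refine mul_le_mul hKH hmain ?_ (by positivity)
        exact Finset.sum_nonneg fun m _ => div_nonneg (hD0 m) (Nat.cast_nonneg _)
    _ = 2 * (H / Q ^ (1 / 8 : ℝ) * Z) + (2 * (2 * (k : ℝ) + 1) ^ (k - 1)) * (H / q * Z) := by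
        rw [hpow]; ring
    _ ≤ C * (H / Q ^ (1 / 8 : ℝ) * Z) + C * (H / q * Z) := by
        gcongr
        linarith
    _ = _ := by ring
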